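/- Let $X$ be a complex Banach space and $T$ a bounded linear operator on $X$. For a bounded operator $S$ on a complex normed space $E$ let $N(S)$ and $R(S)$ be its kernel and range, $\alpha(S)=\dim N(S)$ and $\beta(S)=\dim E/R(S)$ in $\mathbb N\cup\{\infty\}$, and for $n\in\mathbb N=\{0,1,2,\dots\}$ let $S_{[n]}$ be the restriction of $S$ to $R(S^n)$, as an operator on $R(S^n)$. With $\inf\emptyset=\infty$, put $$a_e(S)=\inf\{n:\alpha(S_{[n]})<\infty\},\qquad d_e(S)=\inf\{n:\beta(S_{[n]})<\infty\},$$ $$m_S=\inf\{n:\min(\alpha(S_{[n]}),\beta(S_{[n]}))<\infty\},\qquad \mathrm{dis}(S)=\inf\{m: N(S_{[m]})=N(S_{[r]})\text{ for all } r\ge m\}.$$ $S$ is upper semi-B-Fredholm if $a_e(S)<\infty$ and $R(S^{a_e(S)+1})$ is closed, lower semi-B-Fredholm if $d_e(S)<\infty$ and $R(S^{d_e(S)})$ is closed, and semi-B-Fredholm if it is upper or lower semi-B-Fredholm; in that case $\mathrm{ind}(S)=\alpha(S_{[m_S]})-\beta(S_{[m_S]})\in\mathbb Z\cup\{\pm\infty\}$.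 $S$ is semi-regular if $R(S)$ is closed and $\mathrm{dis}(S)=0$. Put $\gamma(S)=\inf\{\|Sx\|/\mathrm{dist}(x,N(S)):x\notin N(S)\}\in[0,\infty]$. For $S$ semi-B-Fredholm on a Banach space, with $\varepsilon=\gamma(S_{[\mathrm{dis}(S)]})>0$ and any $\lambda$ with $0<|\lambda|<\varepsilon$, $$\mathrm{jump}(S)=\begin{cases}\alpha(S_{[m_S]})-\alpha(S-\lambda I)&\text{if } S \text{ is upper semi-B-Fredholm},\\ \beta(S_{[m_S]})-\beta(S-\lambda I)&\text{if } S \text{ is lower semi-B-Fredholm};\end{cases}$$ that this is well defined (that $m_S$ and $\mathrm{dis}(S)$ are finite, that $\varepsilon>0$, that the value does not depend on $\lambda$, and that the two cases agree when both apply) is part of the assertion below for the operator concerned. **Theorem.** If $T$ is semi-B-Fredholm, then $m_T$ and $d=\mathrm{dis}(T)$ are finite and there are closed $T$-invariant subspaces $M,N$ of $X$ with $X=M\oplus N$ such that, $T_M$ and $T_N$ denoting the restrictions of $T$ to $M$ and to $N$: 1. $\dim N<\infty$; 2. $T_M$ is semi-B-Fredholm and $\mathrm{jump}(T_M)=0$;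 moreover $\mathrm{dis}(T_M)=m_T$, and $(T_M)_{[m_T]}$ is semi-regular; 3. $T_N$ is nilpotent of degree $d$, that is, $d$ is the least $n\ge 0$ with $T_N^n=0$; 4. $\mathrm{ind}(T)=\mathrm{ind}(T_M)$. -/

import Mathlib

open scoped ENNReal

noncomputable section

namespace SemiBFredholm

/-- `α(T)`: the dimension of the kernel, in `ℕ ∪ {∞}`. -/
def nullity {E : Type*} [NormedAddCommGroup E] [NormedSpace ℂ E] (T : E →L[ℂ] E) : ℕ∞ :=
  Cardinal.toENat (Module.rank ℂ (LinearMap.ker (T : E →ₗ[ℂ] E)))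

/-- `β(T)`: the (algebraic) codimension of the range, in `ℕ ∪ {∞}`. -/
def defect {E : Type*} [NormedAddCommGroup E] [NormedSpace ℂ E] (T : E →L[ℂ] E) : ℕ∞ :=
  Cardinal.toENat (Module.rank ℂ (E ⧸ LinearMap.range (T : E →ₗ[ℂ] E)))

/-- `R(T ^ n)` as a linear subspace. -/
def rangePow {E : Type*} [NormedAddCommGroup E] [NormedSpace ℂ E] (T : E →L[ℂ] E) (n : ℕ) :
    Submodule ℂ E :=
  LinearMap.range ((T ^ n : E →L[ℂ] E) : E →ₗ[ℂ] E)

theorem map_mem_rangePow {E : Type*} [NormedAddCommGroup E] [NormedSpace ℂ E] (T : E →L[ℂ] E)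
    (n : ℕ) : ∀ x ∈ rangePow T n, T x ∈ rangePow T n := by
  rintro x ⟨y, rfl⟩
  refine ⟨T y, ?_⟩
  have h : T ^ n * T = T * T ^ n := (pow_succ T n).symm.trans (pow_succ' T n)
  exact congrArg (fun S : E →L[ℂ] E => S y) h

/-- `T_[n]`: the restriction of `T` to the range of `T ^ n`, as an operator on that subspace. -/
def restrPow {E : Type*} [NormedAddCommGroup E] [NormedSpace ℂ E] (T : E →L[ℂ] E) (n : ℕ) :
    rangePow T n →L[ℂ] rangePow T n :=
  T.restrict (map_mem_rangePow T n)

/-- The essential ascent `a_e(T) = inf {n : α(T_[n]) < ∞}`, with `inf ∅ = ∞`. -/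
def essAscent {E : Type*} [NormedAddCommGroup E] [NormedSpace ℂ E] (T : E →L[ℂ] E) : ℕ∞ :=
  ⨅ (n : ℕ) (_ : nullity (restrPow T n) < ⊤), (n : ℕ∞)

/-- The essential descent `d_e(T) = inf {n : β(T_[n]) < ∞}`, with `inf ∅ = ∞`. -/
def essDescent {E : Type*} [NormedAddCommGroup E] [NormedSpace ℂ E] (T : E →L[ℂ] E) : ℕ∞ :=
  ⨅ (n : ℕ) (_ : defect (restrPow T n) < ⊤), (n : ℕ∞)

/-- The essential degree `m_T = inf {n : min (α(T_[n]), β(T_[n])) < ∞}`, with `inf ∅ = ∞`. -/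
def essDegree {E : Type*} [NormedAddCommGroup E] [NormedSpace ℂ E] (T : E →L[ℂ] E) : ℕ∞ :=
  ⨅ (n : ℕ) (_ : min (nullity (restrPow T n)) (defect (restrPow T n)) < ⊤), (n : ℕ∞)

/-- `a_e(T) < ∞` and `R(T ^ (a_e(T) + 1))` is closed. -/
def IsUpperSemiBFredholm {E : Type*} [NormedAddCommGroup E] [NormedSpace ℂ E]
    (T : E →L[ℂ] E) : Prop :=
  ∃ a : ℕ, essAscent T = a ∧ IsClosed (rangePow T (a + 1) : Set E)

/-- `d_e(T) < ∞` and `R(T ^ d_e(T))` is closed. -/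
def IsLowerSemiBFredholm {E : Type*} [NormedAddCommGroup E] [NormedSpace ℂ E]
    (T : E →L[ℂ] E) : Prop :=
  ∃ b : ℕ, essDescent T = b ∧ IsClosed (rangePow T b : Set E)

def IsSemiBFredholm {E : Type*} [NormedAddCommGroup E] [NormedSpace ℂ E]
    (T : E →L[ℂ] E) : Prop :=
  IsUpperSemiBFredholm T ∨ IsLowerSemiBFredholm T

/-- `ind(T) = α(T_[m]) - β(T_[m])` with `m = m_T`, valued in the extended reals. For a
semi-B-Fredholm operator `m_T` is finite and at most one of the two terms is infinite, so the
subtraction is meaningful. -/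
def index {E : Type*} [NormedAddCommGroup E] [NormedSpace ℂ E] (T : E →L[ℂ] E) : EReal :=
  (((nullity (restrPow T (essDegree T).toNat) : ℕ∞) : ℝ≥0∞) : EReal) -
    (((defect (restrPow T (essDegree T).toNat) : ℕ∞) : ℝ≥0∞) : EReal)

/-- `N(T_[n])` as a subspace of the whole space. -/
def kerRestrPow {E : Type*} [NormedAddCommGroup E] [NormedSpace ℂ E] (T : E →L[ℂ] E) (n : ℕ) :
    Submodule ℂ E :=
  (LinearMap.ker (restrPow T n : rangePow T n →ₗ[ℂ] rangePow T n)).map (rangePow T n).subtype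

theorem kerRestrPow_eq {E : Type*} [NormedAddCommGroup E] [NormedSpace ℂ E] (T : E →L[ℂ] E)
    (n : ℕ) :
    kerRestrPow T n = LinearMap.ker (T : E →ₗ[ℂ] E) ⊓ rangePow T n := by
  ext x
  constructor
  · rintro ⟨y, hy, rfl⟩
    exact ⟨congrArg Subtype.val (LinearMap.mem_ker.mp hy), y.2⟩
  · rintro ⟨hx, hxr⟩
    exact ⟨⟨x, hxr⟩, LinearMap.mem_ker.mpr (Subtype.ext hx), rfl⟩

/-- The degree of stable iteration `dis(T)`: the infimum (`∞` if there is none) of the `m` such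
that `N(T_[m]) = N(T_[r])` for every `r ≥ m`. -/
def dis {E : Type*} [NormedAddCommGroup E] [NormedSpace ℂ E] (T : E →L[ℂ] E) : ℕ∞ :=
  ⨅ (m : ℕ) (_ : ∀ r : ℕ, m ≤ r → kerRestrPow T m = kerRestrPow T r), (m : ℕ∞)

/-- `T` is semi-regular: its range is closed and `dis(T) = 0`. -/
def IsSemiRegular {E : Type*} [NormedAddCommGroup E] [NormedSpace ℂ E] (T : E →L[ℂ] E) : Prop :=
  IsClosed (LinearMap.range (T : E →ₗ[ℂ] E) : Set E) ∧ dis T = 0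

/-- The reduced minimum modulus `γ(T) = inf {‖T x‖ / dist(x, N(T)) : x ∉ N(T)}`, in `[0, ∞]`
(so `γ(0) = ∞`). -/
def reducedMinModulus {E : Type*} [NormedAddCommGroup E] [NormedSpace ℂ E]
    (T : E →L[ℂ] E) : ℝ≥0∞ :=
  ⨅ (x : E) (_ : x ∉ LinearMap.ker (T : E →ₗ[ℂ] E)),
    ENNReal.ofReal (‖T x‖ / Metric.infDist x (LinearMap.ker (T : E →ₗ[ℂ] E) : Set E))

/-- `jump(T) = j`. Here `T` is semi-B-Fredholm, `m = m_T`, `d = dis(T)`, `ε = γ(T_[d]) > 0`, and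
for every `z` with `0 < |z| < ε` one has `j = α(T_[m]) - α(T - z I)` if `T` is upper
semi-B-Fredholm and `j = β(T_[m]) - β(T - z I)` if `T` is lower semi-B-Fredholm. (The minuends
are finite in the respective cases, so the equations written additively determine `j`.) -/
def HasJump {E : Type*} [NormedAddCommGroup E] [NormedSpace ℂ E] (T : E →L[ℂ] E) (j : ℕ) : Prop :=
  IsSemiBFredholm T ∧
  ∃ m d : ℕ, essDegree T = m ∧ dis T = d ∧
    0 < reducedMinModulus (restrPow T d) ∧
    (IsUpperSemiBFredholm T → ∀ z : ℂ, z ≠ 0 → ‖z‖ₑ < reducedMinModulus (restrPow T d) →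
      nullity (restrPow T m) = nullity (T - z • ContinuousLinearMap.id ℂ E) + j) ∧
    (IsLowerSemiBFredholm T → ∀ z : ℂ, z ≠ 0 → ‖z‖ₑ < reducedMinModulus (restrPow T d) →
      defect (restrPow T m) = defect (T - z • ContinuousLinearMap.id ℂ E) + j)

/-- `(M, N) ∈ Red(T)`: `M` and `N` are closed `T`-invariant subspaces with `E = M ⊕ N`. -/
structure IsReducedBy {E : Type*} [NormedAddCommGroup E] [NormedSpace ℂ E] (T : E →L[ℂ] E)
    (M N : Submodule ℂ E) : Prop where
  isClosed_left : IsClosed (M : Set E)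
  isClosed_right : IsClosed (N : Set E)
  map_left : ∀ x ∈ M, T x ∈ M
  map_right : ∀ x ∈ N, T x ∈ N
  isCompl : IsCompl M N

end SemiBFredholm

end

/-!
Why a semi-B-Fredholm operator `T` is the direct sum of a jump-free operator and a nilpotent one.

Passing from `T_[n]` to `T_[n+1]` lowers nullity and defect by the same amount, the dimension of
`N(T_[n]) / N(T_[n+1])` (`exists_nullity_defect_step`). Hence all these amounts with `n ≥ m = m_T`
have a finite sum, `d = dis T` is finite and `m ≤ d`. Moreover `R(Tⁿ)` is closed for all `n ≥ m`
(`IsSemiBFredholm.exists_essDegree_eq`).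

If `d > 0`, a vector `T ^ (d - 1) u` of the kernel which is not in the closed subspace `R(T ^ d)`
and a continuous functional separating it from `R(T ^ d)` split off a Jordan block of size `d`
(`exists_isReducedBy_of_dis_eq_succ`). On such a block nullity and defect of the restrictions are
equal and finite, so the summand that remains has the same essential degree and index. If `d = m`,
one block suffices. If `d > m`, the number `min (α(T_[m])) (β(T_[m]))` is strictly smaller for the
remaining summand than for `T`, and after finitely many blocks an operator remains whose iteration
is stable from `m` on (`exists_isReducedBy_stableFrom`). All the blocks together form `N`; the first
of them has size `d`, which is the degree of `T_N`.

Let `S` be the operator that remains and `A = S_[m]`, a semi-regular operator on a Banach space. For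
`z ≠ 0` nullity and defect of `S - z` are those of `A - z`. That they agree with those of `A` for
`‖z‖ < γ(A)` is reduced to two special cases. For the nullity, `A` is replaced by its restriction
to `⋂ R(Aⁿ)`, which is surjective. For the defect, it is replaced by the operator it induces on the
quotient by the closure of `⋃ N(Aⁿ)`, which is bounded below. In both cases the relevant dimension
is locally constant in `z` where it is finite, because of a one-sided inverse, and lower
semicontinuous everywhere; so a finite value at `0` persists on the whole disc, which is connected
(`nullity_sub_smul_of_surjective`, `defect_sub_smul_of_bound`).
-/

namespace SemiBFredholm

/-! ### Dimensions in `ℕ∞` -/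

/-- The dimension of a complex vector space, in `ℕ ∪ {∞}`. -/
noncomputable def eDim (V : Type*) [AddCommGroup V] [Module ℂ V] : ℕ∞ :=
  Cardinal.toENat (Module.rank ℂ V)

section eDim

variable {U V W : Type*} [AddCommGroup U] [Module ℂ U] [AddCommGroup V] [Module ℂ V]
  [AddCommGroup W] [Module ℂ W]

theorem eDim_congr (e : V ≃ₗ[ℂ] W) : eDim V = eDim W := by
  have h := congrArg Cardinal.toENat e.lift_rank_eq
  rwa [Cardinal.toENat_lift, Cardinal.toENat_lift] at h

theorem eDim_prod : eDim (V × W) = eDim V + eDim W := by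
  simp only [eDim, rank_prod, map_add, Cardinal.toENat_lift]

theorem eDim_lt_top : eDim V < ⊤ ↔ FiniteDimensional ℂ V := by
  rw [eDim, Cardinal.toENat_lt_top, Module.rank_lt_aleph0_iff]

theorem eDim_eq_finrank [FiniteDimensional ℂ V] : eDim V = Module.finrank ℂ V := by
  rw [eDim, ← Module.finrank_eq_rank, Cardinal.toENat_nat]

theorem eDim_eq_zero : eDim V = 0 ↔ Subsingleton V := by
  rw [eDim, Cardinal.toENat_eq_zero, rank_zero_iff]

theorem eDim_of_surjective (f : V →ₗ[ℂ] W) (hf : Function.Surjective f) :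
    eDim V = eDim (LinearMap.ker f) + eDim W := by
  rw [← eDim_congr (f.quotKerEquivOfSurjective hf)]
  have h := congrArg Cardinal.toENat (Submodule.rank_quotient_add_rank (LinearMap.ker f))
  rw [map_add] at h
  rw [eDim, ← h, add_comm]
  rfl

theorem natCast_le_eDim {n : ℕ} :
    (n : ℕ∞) ≤ eDim V ↔ ∃ v : Fin n → V, LinearIndependent ℂ v := by
  rw [eDim, Cardinal.natCast_le_toENat, Module.le_rank_iff]

/-- The dimension of the kernel is additive on direct sums of operators. -/
theorem eDim_ker_of_prod (f : V →ₗ[ℂ] V) (g : W →ₗ[ℂ] W) (h : U →ₗ[ℂ] U) (e : (V × W) ≃ₗ[ℂ] U)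
    (he : ∀ x y, h (e (x, y)) = e (f x, g y)) :
    eDim (LinearMap.ker h) = eDim (LinearMap.ker f) + eDim (LinearMap.ker g) := by
  rw [← eDim_prod]
  let i : (LinearMap.ker f × LinearMap.ker g) →ₗ[ℂ] LinearMap.ker h :=
    LinearMap.codRestrict _
      (e.toLinearMap ∘ₗ (LinearMap.ker f).subtype.prodMap (LinearMap.ker g).subtype)
      (by
        rintro ⟨⟨x, hx⟩, ⟨y, hy⟩⟩
        rw [LinearMap.mem_ker] at hx hy
        simp [he, hx, hy])
  refine (eDim_congr (LinearEquiv.ofBijective i ⟨?_, ?_⟩)).symm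
  · rw [injective_iff_map_eq_zero]
    rintro ⟨⟨x, hx⟩, ⟨y, hy⟩⟩ h0
    have h1 : e (x, y) = 0 := congrArg Subtype.val h0
    simpa using h1
  · rintro ⟨u, hu⟩
    obtain ⟨⟨x, y⟩, rfl⟩ := e.surjective u
    have h1 : e (f x, g y) = 0 := (he x y).symm.trans hu
    have h2 : f x = 0 ∧ g y = 0 := by simpa using h1
    exact ⟨(⟨x, h2.1⟩, ⟨y, h2.2⟩), rfl⟩

/-- The codimension of the range is additive on direct sums of operators. -/
theorem eDim_quotient_range_of_prod (f : V →ₗ[ℂ] V) (g : W →ₗ[ℂ] W) (h : U →ₗ[ℂ] U)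
    (e : (V × W) ≃ₗ[ℂ] U) (he : ∀ x y, h (e (x, y)) = e (f x, g y)) :
    eDim (U ⧸ LinearMap.range h) =
      eDim (V ⧸ LinearMap.range f) + eDim (W ⧸ LinearMap.range g) := by
  rw [← eDim_prod]
  let q : U →ₗ[ℂ] (V ⧸ LinearMap.range f) × (W ⧸ LinearMap.range g) :=
    (LinearMap.range f).mkQ.prodMap (LinearMap.range g).mkQ ∘ₗ e.symm.toLinearMap
  have hq : Function.Surjective q := by
    have := (Submodule.mkQ_surjective (LinearMap.range f)).prodMap
      (Submodule.mkQ_surjective (LinearMap.range g))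
    exact this.comp e.symm.surjective
  have hk : LinearMap.range h = LinearMap.ker q := by
    ext u
    obtain ⟨⟨x, y⟩, rfl⟩ := e.surjective u
    have : e (x, y) ∈ LinearMap.ker q ↔ x ∈ LinearMap.range f ∧ y ∈ LinearMap.range g := by
      simp [q]
    rw [this]
    constructor
    · rintro ⟨u', hu'⟩
      obtain ⟨⟨x', y'⟩, rfl⟩ := e.surjective u'
      rw [he] at hu'
      have := e.injective hu'
      simp only [Prod.mk.injEq] at this
      exact ⟨⟨x', this.1⟩, ⟨y', this.2⟩⟩
    · rintro ⟨⟨x', rfl⟩, ⟨y', rfl⟩⟩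
      exact ⟨e (x', y'), he x' y'⟩
  exact (eDim_congr (Submodule.quotEquivOfEq _ _ hk)).trans
    (eDim_congr (q.quotKerEquivOfSurjective hq))

/-- Rank-nullity: on a finite-dimensional space kernel and cokernel have the same dimension. -/
theorem eDim_ker_eq_eDim_quotient_range [FiniteDimensional ℂ V] (f : V →ₗ[ℂ] V) :
    eDim (LinearMap.ker f) = eDim (V ⧸ LinearMap.range f) := by
  rw [eDim_eq_finrank, eDim_eq_finrank]
  have h1 := f.finrank_range_add_finrank_ker
  have h2 := (LinearMap.range f).finrank_quotient_add_finrank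
  congr 1
  omega

end eDim

/-! ### The sequences of nullities and defects -/

section chains

variable {X : Type*} [NormedAddCommGroup X] [NormedSpace ℂ X] (T : X →L[ℂ] X)

theorem mem_rangePow {n : ℕ} {x : X} : x ∈ rangePow T n ↔ ∃ y, (T ^ n) y = x := Iff.rfl

theorem pow_add_apply (m n : ℕ) (x : X) : (T ^ (m + n)) x = (T ^ m) ((T ^ n) x) := by
  rw [pow_add]; rfl

theorem pow_succ_apply' (n : ℕ) (x : X) : (T ^ (n + 1)) x = T ((T ^ n) x) := by
  rw [pow_succ']; rfl

theorem pow_succ_apply (n : ℕ) (x : X) : (T ^ (n + 1)) x = (T ^ n) (T x) := by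
  rw [pow_succ]; rfl

theorem rangePow_antitone : Antitone (rangePow T) := by
  intro m n hmn
  obtain ⟨k, rfl⟩ := Nat.exists_eq_add_of_le hmn
  rintro _ ⟨y, rfl⟩
  exact ⟨(T ^ k) y, (pow_add_apply T m k y).symm⟩

theorem mem_rangePow_succ {n : ℕ} {x : X} :
    x ∈ rangePow T (n + 1) ↔ ∃ y ∈ rangePow T n, T y = x := by
  constructor
  · rintro ⟨y, rfl⟩
    exact ⟨(T ^ n) y, ⟨y, rfl⟩, (pow_succ_apply' T n y).symm⟩
  · rintro ⟨_, ⟨y, rfl⟩, rfl⟩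
    exact ⟨y, pow_succ_apply' T n y⟩

theorem mem_range_restrPow {n : ℕ} (x : rangePow T n) :
    x ∈ LinearMap.range (restrPow T n : rangePow T n →ₗ[ℂ] rangePow T n) ↔
      (x : X) ∈ rangePow T (n + 1) := by
  rw [mem_rangePow_succ]
  constructor
  · rintro ⟨y, rfl⟩
    exact ⟨y, y.2, rfl⟩
  · rintro ⟨y, hy, h⟩
    exact ⟨⟨y, hy⟩, Subtype.ext h⟩

theorem mem_kerRestrPow {n : ℕ} {x : X} :
    x ∈ kerRestrPow T n ↔ T x = 0 ∧ x ∈ rangePow T n := by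
  rw [kerRestrPow_eq]; rfl

theorem kerRestrPow_antitone : Antitone (kerRestrPow T) := by
  intro m n hmn x hx
  rw [mem_kerRestrPow] at hx ⊢
  exact ⟨hx.1, rangePow_antitone T hmn hx.2⟩

theorem nullity_restrPow (n : ℕ) : nullity (restrPow T n) = eDim (kerRestrPow T n) :=
  eDim_congr (Submodule.equivMapOfInjective _ (Submodule.injective_subtype _) _)

/-- The exact sequence `N(T_[n]) → R(Tⁿ)/R(Tⁿ⁺¹) → R(Tⁿ⁺¹)/R(Tⁿ⁺²) → 0`, whose first map has
kernel `N(T_[n+1])`: passing from `n` to `n + 1` lowers nullity and defect by the same amount. -/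
theorem exists_nullity_defect_step (n : ℕ) : ∃ k : ℕ∞,
    nullity (restrPow T n) = k + nullity (restrPow T (n + 1)) ∧
    defect (restrPow T n) = k + defect (restrPow T (n + 1)) ∧
    (k = 0 ↔ kerRestrPow T n = kerRestrPow T (n + 1)) := by
  let r (i : ℕ) := LinearMap.range (restrPow T i : rangePow T i →ₗ[ℂ] rangePow T i)
  have hle : kerRestrPow T n ≤ rangePow T n := fun x hx => ((mem_kerRestrPow T).1 hx).2
  let ψ : kerRestrPow T n →ₗ[ℂ] (rangePow T n ⧸ r n) := (r n).mkQ ∘ₗ Submodule.inclusion hle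
  let τ : rangePow T n →ₗ[ℂ] rangePow T (n + 1) :=
    LinearMap.codRestrict _ ((T : X →ₗ[ℂ] X) ∘ₗ (rangePow T n).subtype)
      (fun x => (mem_rangePow_succ T).2 ⟨x, x.2, rfl⟩)
  have hτ : r n ≤ (r (n + 1)).comap τ := by
    intro x hx
    have hx' := (mem_range_restrPow T x).1 hx
    exact (mem_range_restrPow T _).2 ((mem_rangePow_succ T).2 ⟨x, hx', rfl⟩)
  let φ : (rangePow T n ⧸ r n) →ₗ[ℂ] (rangePow T (n + 1) ⧸ r (n + 1)) := (r n).mapQ _ τ hτ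
  have hφ : Function.Surjective φ := by
    intro y
    obtain ⟨⟨y, hy⟩, rfl⟩ := Submodule.mkQ_surjective _ y
    obtain ⟨x, hx, rfl⟩ := (mem_rangePow_succ T).1 hy
    exact ⟨(r n).mkQ ⟨x, hx⟩, rfl⟩
  have hψ (x : kerRestrPow T n) : ψ x = 0 ↔ (x : X) ∈ kerRestrPow T (n + 1) := by
    have h1 : ψ x = 0 ↔ Submodule.inclusion hle x ∈ r n := Submodule.Quotient.mk_eq_zero _
    rw [h1, mem_range_restrPow, mem_kerRestrPow]
    exact ⟨fun h => ⟨((mem_kerRestrPow T).1 x.2).1, h⟩, fun h => h.2⟩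
  have hker : LinearMap.ker φ = LinearMap.range ψ := by
    ext y
    obtain ⟨⟨y, hy⟩, rfl⟩ := Submodule.mkQ_surjective _ y
    have h1 : (r n).mkQ ⟨y, hy⟩ ∈ LinearMap.ker φ ↔ T y ∈ rangePow T (n + 1 + 1) := by
      have : φ ((r n).mkQ ⟨y, hy⟩) = 0 ↔ τ ⟨y, hy⟩ ∈ r (n + 1) := Submodule.Quotient.mk_eq_zero _
      exact this.trans (mem_range_restrPow T _)
    rw [h1]
    constructor
    · intro h
      obtain ⟨z, hz, hzy⟩ := (mem_rangePow_succ T).1 h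
      refine ⟨⟨y - z, (mem_kerRestrPow T).2 ⟨?_, ?_⟩⟩, ?_⟩
      · rw [map_sub, hzy, sub_self]
      · exact sub_mem hy (rangePow_antitone T n.le_succ hz)
      · refine (Submodule.Quotient.eq _).2 ((mem_range_restrPow T _).2 ?_)
        simpa using hz
    · rintro ⟨⟨x, hx⟩, hxy⟩
      have h2 := (mem_range_restrPow T _).1 ((Submodule.Quotient.eq _).1 hxy)
      have h3 : T (x - y) ∈ rangePow T (n + 1 + 1) := (mem_rangePow_succ T).2 ⟨_, h2, rfl⟩
      rw [map_sub, ((mem_kerRestrPow T).1 hx).1, zero_sub] at h3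
      simpa using neg_mem h3
  refine ⟨eDim (LinearMap.range ψ), ?_, ?_, ?_⟩
  · rw [nullity_restrPow, nullity_restrPow,
      eDim_of_surjective ψ.rangeRestrict ψ.surjective_rangeRestrict, LinearMap.ker_rangeRestrict,
      add_comm]
    congr 1
    have : (LinearMap.ker ψ).map (kerRestrPow T n).subtype = kerRestrPow T (n + 1) := by
      ext x
      constructor
      · rintro ⟨y, hy, rfl⟩
        exact (hψ y).1 hy
      · intro hx
        exact ⟨⟨x, kerRestrPow_antitone T n.le_succ hx⟩, (hψ _).2 hx, rfl⟩
    rw [← this]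
    exact eDim_congr (Submodule.equivMapOfInjective _ (Submodule.injective_subtype _) _)
  · rw [← hker]
    exact eDim_of_surjective φ hφ
  · rw [eDim_eq_zero, Submodule.subsingleton_iff_eq_bot, LinearMap.range_eq_bot]
    constructor
    · intro h
      refine le_antisymm (fun x hx => ?_) (kerRestrPow_antitone T n.le_succ)
      exact (hψ ⟨x, hx⟩).1 (by rw [h]; rfl)
    · intro h
      ext1 x
      exact (hψ x).2 (h ▸ x.2)

end chains

/-! ### Essential ascent, essential descent and stable iteration -/

theorem iInf_natCast_eq_natCast_iff {P : ℕ → Prop} {a : ℕ} :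
    (⨅ (n : ℕ) (_ : P n), (n : ℕ∞)) = a ↔ P a ∧ ∀ b, P b → a ≤ b := by
  classical
  have key (c : ℕ) (hc : P c) (hmin : ∀ b, P b → c ≤ b) :
      (⨅ (n : ℕ) (_ : P n), (n : ℕ∞)) = c :=
    le_antisymm (iInf₂_le c hc) (le_iInf₂ fun b hb => by exact_mod_cast hmin b hb)
  refine ⟨fun h => ?_, fun h => key a h.1 h.2⟩
  by_cases hex : ∃ n, P n
  · have h0 := key (Nat.find hex) (Nat.find_spec hex) (fun b hb => Nat.find_min' hex hb)
    have : Nat.find hex = a := by exact_mod_cast h0.symm.trans h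
    subst this
    exact ⟨Nat.find_spec hex, fun b hb => Nat.find_min' hex hb⟩
  · simp only [not_exists] at hex
    simp [hex] at h

section

variable {X : Type*} [NormedAddCommGroup X] [NormedSpace ℂ X] (T : X →L[ℂ] X)

theorem nullity_restrPow_antitone : Antitone fun n => nullity (restrPow T n) := by
  refine antitone_nat_of_succ_le fun n => ?_
  obtain ⟨k, h, -, -⟩ := exists_nullity_defect_step T n
  rw [h]
  exact le_add_self

theorem defect_restrPow_antitone : Antitone fun n => defect (restrPow T n) := by
  refine antitone_nat_of_succ_le fun n => ?_
  obtain ⟨k, -, h, -⟩ := exists_nullity_defect_step T n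
  rw [h]
  exact le_add_self

theorem nullity_restrPow_lt_top_of_defect {n p : ℕ} (hnp : n ≤ p)
    (hd : defect (restrPow T n) < ⊤) (ha : nullity (restrPow T p) < ⊤) :
    nullity (restrPow T n) < ⊤ := by
  induction p, hnp using Nat.le_induction with
  | base => exact ha
  | succ p hnp ih =>
    refine ih ?_
    obtain ⟨k, h1, h2, -⟩ := exists_nullity_defect_step T p
    have h3 : k < ⊤ :=
      (le_self_add.trans h2.ge).trans_lt ((defect_restrPow_antitone T hnp).trans_lt hd)
    rw [h1]
    exact ENat.add_lt_top.2 ⟨h3, ha⟩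

theorem defect_restrPow_lt_top_of_nullity {n p : ℕ} (hnp : n ≤ p)
    (ha : nullity (restrPow T n) < ⊤) (hd : defect (restrPow T p) < ⊤) :
    defect (restrPow T n) < ⊤ := by
  induction p, hnp using Nat.le_induction with
  | base => exact hd
  | succ p hnp ih =>
    refine ih ?_
    obtain ⟨k, h1, h2, -⟩ := exists_nullity_defect_step T p
    have h3 : k < ⊤ :=
      (le_self_add.trans h1.ge).trans_lt ((nullity_restrPow_antitone T hnp).trans_lt ha)
    rw [h2]
    exact ENat.add_lt_top.2 ⟨h3, hd⟩

theorem essDegree_eq_of_essAscent_eq {a : ℕ} (h : essAscent T = a) : essDegree T = a := by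
  obtain ⟨h1, h2⟩ := iInf_natCast_eq_natCast_iff.1 h
  refine iInf_natCast_eq_natCast_iff.2 ⟨min_lt_iff.2 (.inl h1), fun b hb => ?_⟩
  rcases min_lt_iff.1 hb with hb | hb
  · exact h2 b hb
  · by_contra! hlt
    exact hlt.not_ge (h2 b (nullity_restrPow_lt_top_of_defect T hlt.le hb h1))

theorem essDegree_eq_of_essDescent_eq {b : ℕ} (h : essDescent T = b) : essDegree T = b := by
  obtain ⟨h1, h2⟩ := iInf_natCast_eq_natCast_iff.1 h
  refine iInf_natCast_eq_natCast_iff.2 ⟨min_lt_iff.2 (.inr h1), fun a ha => ?_⟩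
  rcases min_lt_iff.1 ha with ha | ha
  · by_contra! hlt
    exact hlt.not_ge (h2 a (defect_restrPow_lt_top_of_nullity T hlt.le ha h1))
  · exact h2 a ha

/-- The sequence `N(T_[n])` is constant from `n = m` on. -/
def StableFrom (m : ℕ) : Prop := ∀ r : ℕ, m ≤ r → kerRestrPow T m = kerRestrPow T r

variable {T}

theorem StableFrom.mono {m n : ℕ} (h : StableFrom T m) (hmn : m ≤ n) : StableFrom T n :=
  fun r hr => (h n hmn).symm.trans (h r (hmn.trans hr))

theorem dis_eq_natCast_iff {d : ℕ} :
    dis T = d ↔ StableFrom T d ∧ ∀ b, StableFrom T b → d ≤ b :=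
  iInf_natCast_eq_natCast_iff

theorem StableFrom.nullity_eq {m n : ℕ} (h : StableFrom T m) (hmn : m ≤ n) :
    nullity (restrPow T m) = nullity (restrPow T n) := by
  rw [nullity_restrPow, nullity_restrPow, h n hmn]

theorem StableFrom.defect_eq {m n : ℕ} (h : StableFrom T m) (hmn : m ≤ n) :
    defect (restrPow T m) = defect (restrPow T n) := by
  induction n, hmn using Nat.le_induction with
  | base => rfl
  | succ n hmn ih =>
    obtain ⟨k, -, h2, h3⟩ := exists_nullity_defect_step T n
    have hk : k = 0 := h3.2 (h.mono hmn (n + 1) n.le_succ)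
    rw [ih, h2, hk, zero_add]

/-- If one of the sequences of nullities and defects becomes finite, the sequence `N(T_[n])`
stabilizes. -/
theorem exists_stableFrom {m : ℕ}
    (h : min (nullity (restrPow T m)) (defect (restrPow T m)) < ⊤) : ∃ d, StableFrom T d := by
  choose k h1 h2 h3 using exists_nullity_defect_step T
  suffices H : ∃ d, ∀ n, d ≤ n → k n = 0 by
    obtain ⟨d, hd⟩ := H
    refine ⟨d, fun r hr => ?_⟩
    induction r, hr using Nat.le_induction with
    | base => rfl
    | succ r hr ih => exact ih.trans ((h3 r).1 (hd r hr))
  have key (f : ℕ → ℕ∞) (hf : ∀ n, f n = k n + f (n + 1)) (hm : f m < ⊤) :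
      ∃ d, ∀ n, d ≤ n → k n = 0 := by
    have hanti : Antitone f := antitone_nat_of_succ_le fun n => by
      rw [hf n]
      exact le_add_self
    -- The sequence is constant from an index on at which it takes its least value.
    obtain ⟨n₀, hn₀⟩ := exists_minimal_of_wellFoundedLT (fun y => y ∈ Set.range f) ⟨_, m, rfl⟩
    obtain ⟨⟨p, rfl⟩, hp⟩ := hn₀
    have hle (n : ℕ) : f p ≤ f n := by
      rcases le_total (f p) (f n) with h | h
      · exact h
      · exact hp ⟨n, rfl⟩ h
    refine ⟨p, fun n hn => ?_⟩
    have heq : f n = f (n + 1) :=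
      le_antisymm ((hanti hn).trans (hle _)) (hanti n.le_succ)
    have hfin : f (n + 1) ≠ ⊤ := ((hanti (hn.trans n.le_succ)).trans (hle m)).trans_lt hm |>.ne
    have := hf n
    rw [heq] at this
    exact (ENat.add_left_injective_of_ne_top hfin (by simpa using this)).symm
  rcases min_lt_iff.1 h with h | h
  · exact key _ h1 h
  · exact key _ h2 h

theorem exists_dis_eq {m : ℕ}
    (h : min (nullity (restrPow T m)) (defect (restrPow T m)) < ⊤) : ∃ d : ℕ, dis T = d := by
  classical
  have hex := exists_stableFrom h
  exact ⟨Nat.find hex, dis_eq_natCast_iff.2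
    ⟨Nat.find_spec hex, fun b hb => Nat.find_min' hex hb⟩⟩

/-- In particular `m_T ≤ dis T`: nullities and defects are constant from `dis T` on. -/
theorem essDegree_le_of_stableFrom {m n : ℕ} (hm : essDegree T = m) (h : StableFrom T n) :
    m ≤ n := by
  obtain ⟨h1, h2⟩ := iInf_natCast_eq_natCast_iff.1 hm
  by_contra! hlt
  refine hlt.not_ge (h2 n ?_)
  rwa [h.nullity_eq hlt.le, h.defect_eq hlt.le]

end

/-! ### Closedness of the ranges of the powers -/

theorem isClosed_of_isClosed_preimage_subtype {F : Type*} [NormedAddCommGroup F]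
    [NormedSpace ℂ F] {p q : Submodule ℂ F} (hle : p ≤ q)
    (hq : IsClosed (q : Set F)) (h : IsClosed ((Subtype.val : q → F) ⁻¹' (p : Set F))) :
    IsClosed (p : Set F) := by
  have himg := hq.isClosedEmbedding_subtypeVal.isClosedMap _ h
  have heq : (Subtype.val : q → F) '' ((Subtype.val : q → F) ⁻¹' (p : Set F)) = p := by
    ext x
    exact ⟨fun ⟨y, hy, hyx⟩ => hyx ▸ hy, fun hx => ⟨⟨x, hle hx⟩, hx, rfl⟩⟩
  exact (congrArg IsClosed heq).mp himg

section

variable {E F : Type*} [NormedAddCommGroup E] [NormedSpace ℂ E] [CompleteSpace E]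
  [NormedAddCommGroup F] [NormedSpace ℂ F] [CompleteSpace F]

/-- An operator range whose sum and whose intersection with a closed subspace `G` are closed is
closed: `(x, g) ↦ f x + g` is a quotient map onto the sum, and the preimage of the range is
`E × (range f ⊓ G)`. -/
theorem isClosed_range_of_sup_of_inf (f : E →L[ℂ] F) (G : Submodule ℂ F)
    (hG : IsClosed (G : Set F))
    (hsup : IsClosed ((LinearMap.range (f : E →ₗ[ℂ] F) ⊔ G : Submodule ℂ F) : Set F))
    (hinf : IsClosed ((LinearMap.range (f : E →ₗ[ℂ] F) ⊓ G : Submodule ℂ F) : Set F)) :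
    IsClosed (LinearMap.range (f : E →ₗ[ℂ] F) : Set F) := by
  set R := LinearMap.range (f : E →ₗ[ℂ] F) with hR
  have := hG.completeSpace_coe
  have := hsup.completeSpace_coe
  let u : (E × G) →L[ℂ] (R ⊔ G : Submodule ℂ F) :=
    (f.coprod G.subtypeL).codRestrict _ (by
      rintro ⟨x, g⟩
      exact Submodule.add_mem_sup ⟨x, rfl⟩ g.2)
  have hu : Function.Surjective u := by
    rintro ⟨y, hy⟩
    obtain ⟨_, ⟨x, rfl⟩, g, hg, rfl⟩ := Submodule.mem_sup.1 hy
    exact ⟨(x, ⟨g, hg⟩), rfl⟩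
  have hcl : IsClosed ((Subtype.val : (R ⊔ G : Submodule ℂ F) → F) ⁻¹' (R : Set F)) := by
    rw [← (u.isQuotientMap hu).isClosed_preimage]
    have : u ⁻¹' ((Subtype.val : (R ⊔ G : Submodule ℂ F) → F) ⁻¹' (R : Set F)) =
        (fun p : E × G => (p.2 : F)) ⁻¹' ((R ⊓ G : Submodule ℂ F) : Set F) := by
      ext ⟨x, g⟩
      have h1 : f x ∈ R := ⟨x, rfl⟩
      have h2 : f x + g ∈ R ↔ (g : F) ∈ R := Submodule.add_mem_iff_right R h1
      exact ⟨fun h => ⟨h2.1 h, g.2⟩, fun h => h2.2 h.1⟩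
    rw [this]
    exact hinf.preimage (continuous_subtype_val.comp continuous_snd)
  exact isClosed_of_isClosed_preimage_subtype le_sup_left hsup hcl

theorem isClosed_range_of_finiteDimensional_quotient (f : E →L[ℂ] F)
    [FiniteDimensional ℂ (F ⧸ LinearMap.range (f : E →ₗ[ℂ] F))] :
    IsClosed (LinearMap.range (f : E →ₗ[ℂ] F) : Set F) := by
  obtain ⟨G, hG⟩ := (LinearMap.range (f : E →ₗ[ℂ] F)).exists_isCompl
  have : FiniteDimensional ℂ G := (Submodule.quotientEquivOfIsCompl _ _ hG).finiteDimensional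
  refine isClosed_range_of_sup_of_inf f G G.closed_of_finiteDimensional ?_ ?_
  · rw [hG.sup_eq_top]
    exact isClosed_univ
  · rw [hG.inf_eq_bot]
    exact isClosed_singleton

end

section

variable {X : Type*} [NormedAddCommGroup X] [NormedSpace ℂ X] (T : X →L[ℂ] X)

theorem range_restrPow_eq_preimage (n : ℕ) :
    (LinearMap.range (restrPow T n : rangePow T n →ₗ[ℂ] rangePow T n) : Set (rangePow T n)) =
      Subtype.val ⁻¹' (rangePow T (n + 1) : Set X) := by
  ext x
  exact mem_range_restrPow T x

theorem isClosed_rangePow_succ {n : ℕ} (h : IsClosed (rangePow T n : Set X))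
    (h' : IsClosed (LinearMap.range (restrPow T n : rangePow T n →ₗ[ℂ] rangePow T n) :
      Set (rangePow T n))) : IsClosed (rangePow T (n + 1) : Set X) := by
  rw [range_restrPow_eq_preimage] at h'
  exact isClosed_of_isClosed_preimage_subtype (rangePow_antitone T n.le_succ) h h'

theorem finiteDimensional_kerRestrPow {a : ℕ} (ha : nullity (restrPow T a) < ⊤) :
    FiniteDimensional ℂ (kerRestrPow T a) :=
  eDim_lt_top.1 (by rwa [← nullity_restrPow])

variable [CompleteSpace X] {T}

theorem isClosed_rangePow_of_defect {b n : ℕ} (hb : defect (restrPow T b) < ⊤)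
    (hcl : IsClosed (rangePow T b : Set X)) (hn : b ≤ n) :
    IsClosed (rangePow T n : Set X) := by
  induction n, hn using Nat.le_induction with
  | base => exact hcl
  | succ n hn ih =>
    have := ih.completeSpace_coe
    have hfin := eDim_lt_top.1 ((defect_restrPow_antitone T hn).trans_lt hb)
    exact isClosed_rangePow_succ T ih (isClosed_range_of_finiteDimensional_quotient _)

/-- The sum of `R(T ^ a)` and the kernel of `T` is the preimage of `R(T ^ (a + 1))`. -/
theorem isClosed_rangePow_of_nullity_of_succ {a : ℕ} (ha : nullity (restrPow T a) < ⊤)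
    (hcl : IsClosed (rangePow T (a + 1) : Set X)) : IsClosed (rangePow T a : Set X) := by
  have := finiteDimensional_kerRestrPow T ha
  refine isClosed_range_of_sup_of_inf (T ^ a) (LinearMap.ker (T : X →ₗ[ℂ] X)) T.isClosed_ker ?_ ?_
  · have h1 : LinearMap.range ((T ^ a : X →L[ℂ] X) : X →ₗ[ℂ] X) ⊔ LinearMap.ker (T : X →ₗ[ℂ] X) =
        (rangePow T (a + 1)).comap (T : X →ₗ[ℂ] X) := by
      ext x
      rw [Submodule.mem_comap, Submodule.mem_sup]
      constructor
      · rintro ⟨y, hy, z, hz, rfl⟩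
        have hz' : T z = 0 := hz
        exact (mem_rangePow_succ T).2 ⟨y, hy, by simp [hz']⟩
      · intro hx
        obtain ⟨y, hy, hyx⟩ := (mem_rangePow_succ T).1 hx
        have hyx' : T y = T x := hyx
        exact ⟨y, hy, x - y, by simp [hyx'], by abel⟩
    rw [h1]
    exact hcl.preimage T.continuous
  · rw [inf_comm]
    exact (kerRestrPow_eq T a) ▸ (kerRestrPow T a).closed_of_finiteDimensional

/-- `T` induces a quotient map from `R(T ^ a)` onto `R(T ^ (a + 1))`, under which the preimage of
`R(T ^ (n + 1))` is the sum of `R(T ^ n)` and a finite-dimensional space. -/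
theorem isClosed_rangePow_of_nullity {a n : ℕ} (ha : nullity (restrPow T a) < ⊤)
    (hcl : IsClosed (rangePow T (a + 1) : Set X)) (hn : a ≤ n) :
    IsClosed (rangePow T n : Set X) := by
  have hcl₀ := isClosed_rangePow_of_nullity_of_succ ha hcl
  have := hcl.completeSpace_coe
  have := hcl₀.completeSpace_coe
  have := finiteDimensional_kerRestrPow T ha
  induction n, hn using Nat.le_induction with
  | base => exact hcl₀
  | succ n hn ih =>
    let u : rangePow T a →L[ℂ] rangePow T (a + 1) :=
      (T ∘L (rangePow T a).subtypeL).codRestrict _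
        (fun x => (mem_rangePow_succ T).2 ⟨x, x.2, rfl⟩)
    have hu : Function.Surjective u := by
      rintro ⟨y, hy⟩
      obtain ⟨x, hx, rfl⟩ := (mem_rangePow_succ T).1 hy
      exact ⟨⟨x, hx⟩, rfl⟩
    have hpre : IsClosed ((Subtype.val : rangePow T (a + 1) → X) ⁻¹'
        (rangePow T (n + 1) : Set X)) := by
      rw [← (u.isQuotientMap hu).isClosed_preimage]
      have : u ⁻¹' ((Subtype.val : rangePow T (a + 1) → X) ⁻¹' (rangePow T (n + 1) : Set X)) =
          Subtype.val ⁻¹' ((rangePow T n ⊔ kerRestrPow T a : Submodule ℂ X) : Set X) := by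
        ext ⟨x, hx⟩
        change T x ∈ rangePow T (n + 1) ↔ x ∈ rangePow T n ⊔ kerRestrPow T a
        rw [mem_rangePow_succ, Submodule.mem_sup]
        constructor
        · rintro ⟨y, hy, hyx⟩
          refine ⟨y, hy, x - y, (mem_kerRestrPow T).2 ⟨by simp [hyx], ?_⟩, by abel⟩
          exact sub_mem hx (rangePow_antitone T hn hy)
        · rintro ⟨y, hy, z, hz, rfl⟩
          exact ⟨y, hy, by simp [((mem_kerRestrPow T).1 hz).1]⟩
      rw [this]
      exact (Submodule.isClosed_sup_finiteDimensional _ _ ih).preimage continuous_subtype_val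
    exact isClosed_of_isClosed_preimage_subtype (rangePow_antitone T (Nat.succ_le_succ hn)) hcl hpre

/-- The essential degree of a semi-B-Fredholm operator is finite, and all ranges from there on are
closed. -/
theorem IsSemiBFredholm.exists_essDegree_eq (hT : IsSemiBFredholm T) :
    ∃ m : ℕ, essDegree T = m ∧ min (nullity (restrPow T m)) (defect (restrPow T m)) < ⊤ ∧
      ∀ n, m ≤ n → IsClosed (rangePow T n : Set X) := by
  rcases hT with ⟨a, ha, hcl⟩ | ⟨b, hb, hcl⟩
  · have hfin := (iInf_natCast_eq_natCast_iff.1 ha).1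
    exact ⟨a, essDegree_eq_of_essAscent_eq T ha, min_lt_iff.2 (.inl hfin),
      fun n hn => isClosed_rangePow_of_nullity hfin hcl hn⟩
  · have hfin := (iInf_natCast_eq_natCast_iff.1 hb).1
    exact ⟨b, essDegree_eq_of_essDescent_eq T hb, min_lt_iff.2 (.inr hfin),
      fun n hn => isClosed_rangePow_of_defect hfin hcl hn⟩

end

/-! ### Splitting off a Jordan block of maximal size -/

section

variable {X : Type*} [NormedAddCommGroup X] [NormedSpace ℂ X] {T : X →L[ℂ] X}

theorem coe_restrict_pow_apply {M : Submodule ℂ X} (h : ∀ x ∈ M, T x ∈ M) (n : ℕ) (x : M) :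
    (((T.restrict h) ^ n) x : X) = (T ^ n) x := by
  induction n with
  | zero => rfl
  | succ n ih => rw [pow_succ_apply', pow_succ_apply', ← ih]; rfl

theorem exists_mem_ker_of_dis_eq_succ {p : ℕ} (h : dis T = ((p + 1 : ℕ) : ℕ∞)) :
    ∃ u : X, (T ^ (p + 1)) u = 0 ∧ (T ^ p) u ∉ rangePow T (p + 1) := by
  obtain ⟨h1, h2⟩ := dis_eq_natCast_iff.1 h
  by_contra! hcon
  refine absurd (h2 p fun r hr => ?_) (by omega)
  rcases hr.eq_or_lt with rfl | hr
  · rfl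
  rw [← h1 r hr]
  refine le_antisymm (fun x hx => ?_) (kerRestrPow_antitone T p.le_succ)
  obtain ⟨h3, u, rfl⟩ := (mem_kerRestrPow T).1 hx
  exact (mem_kerRestrPow T).2 ⟨h3, hcon u ((pow_succ_apply' T p u).trans h3)⟩

theorem exists_dual_eq_one_of_notMem {R : Submodule ℂ X} (hR : IsClosed (R : Set X)) {v : X}
    (hv : v ∉ R) : ∃ f : X →L[ℂ] ℂ, f v = 1 ∧ ∀ x ∈ R, f x = 0 := by
  have := hR
  have hne : R.mkQL v ≠ 0 := fun h => hv ((Submodule.Quotient.mk_eq_zero R).1 h)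
  obtain ⟨g, hg⟩ := SeparatingDual.exists_eq_one (R := ℂ) hne
  refine ⟨g ∘L R.mkQL, hg, fun x hx => ?_⟩
  have : R.mkQL x = 0 := (Submodule.Quotient.mk_eq_zero R).2 hx
  simp [this]

/-- If `dis T = p + 1` and `R(T ^ (p + 1))` is closed, then a Jordan block of size `p + 1` splits
off. With `T ^ p u` in the kernel but outside `R(T ^ (p + 1))` and a functional `f` that vanishes
on `R(T ^ (p + 1))` and has `f (T ^ p u) = 1`, the block is spanned by `u, T u, …, T ^ p u` and its
complement consists of the `x` with `f x = f (T x) = ⋯ = f (T ^ p x) = 0`: the matrix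
`f (T ^ (i + j) u)` is triangular with ones on the antidiagonal. -/
theorem exists_isReducedBy_of_dis_eq_succ {p : ℕ} (h : dis T = ((p + 1 : ℕ) : ℕ∞))
    (hcl : IsClosed (rangePow T (p + 1) : Set X)) :
    ∃ (M N : Submodule ℂ X) (hr : IsReducedBy T M N), FiniteDimensional ℂ N ∧
      (T.restrict hr.map_right) ^ (p + 1) = 0 ∧ (T.restrict hr.map_right) ^ p ≠ 0 := by
  obtain ⟨u, hu, hnot⟩ := exists_mem_ker_of_dis_eq_succ h
  obtain ⟨f, hf1, hf0⟩ := exists_dual_eq_one_of_notMem hcl hnot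
  have hf0' (n : ℕ) (hn : p + 1 ≤ n) (x : X) : f ((T ^ n) x) = 0 :=
    hf0 _ (rangePow_antitone T hn ⟨x, rfl⟩)
  have hu' (n : ℕ) (hn : p + 1 ≤ n) : (T ^ n) u = 0 := by
    obtain ⟨k, rfl⟩ := Nat.exists_eq_add_of_le' hn
    rw [pow_add_apply, hu, map_zero]
  let Φ : X →L[ℂ] (Fin (p + 1) → ℂ) := ContinuousLinearMap.pi fun i => f ∘L T ^ (i : ℕ)
  let J : (Fin (p + 1) → ℂ) →ₗ[ℂ] X :=
    Fintype.linearCombination ℂ fun i : Fin (p + 1) => (T ^ (i : ℕ)) u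
  have hΦ (x : X) (i : Fin (p + 1)) : Φ x i = f ((T ^ (i : ℕ)) x) := rfl
  have hJ (c : Fin (p + 1) → ℂ) : J c = ∑ i : Fin (p + 1), c i • (T ^ (i : ℕ)) u :=
    Fintype.linearCombination_apply _ _ _
  have hinj : Function.Injective (Φ.toLinearMap ∘ₗ J) := by
    rw [injective_iff_map_eq_zero]
    intro c hc
    have key : ∀ n (hn : n < p + 1), c ⟨n, hn⟩ = 0 := by
      intro n
      induction n using Nat.strong_induction_on with
      | _ n ih =>
        intro hn
        have h1 : Φ (J c) ⟨p - n, by omega⟩ = 0 := congrFun hc _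
        rw [hΦ, hJ, map_sum, map_sum, Finset.sum_eq_single ⟨n, hn⟩] at h1
        · have h2 : p - n + n = p := by omega
          rw [map_smul, map_smul, ← pow_add_apply] at h1
          dsimp only at h1
          rwa [h2, hf1, smul_eq_mul, mul_one] at h1
        · rintro ⟨l, hl⟩ - hne
          have hne' : l ≠ n := fun h => hne (Fin.ext h)
          rcases lt_or_gt_of_ne hne' with hlt | hgt
          · simp [ih l hlt hl]
          · rw [map_smul, map_smul, ← pow_add_apply]
            dsimp only
            rw [hu' _ (by omega), map_zero, smul_zero]
        · simp
    exact funext fun i => key i i.2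
  have hsurj : Function.Surjective (Φ.toLinearMap ∘ₗ J) := LinearMap.injective_iff_surjective.1 hinj
  have hmem (n : ℕ) : (T ^ n) u ∈ LinearMap.range J := by
    by_cases hn : n < p + 1
    · rw [show J = Fintype.linearCombination ℂ _ from rfl, Fintype.range_linearCombination]
      exact Submodule.subset_span ⟨⟨n, hn⟩, rfl⟩
    · rw [hu' n (by omega)]
      exact zero_mem _
  have hr : IsReducedBy T (LinearMap.ker Φ.toLinearMap) (LinearMap.range J) := by
    refine ⟨Φ.isClosed_ker, Submodule.closed_of_finiteDimensional _, ?_, ?_, ?_⟩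
    · intro x hx
      refine LinearMap.mem_ker.2 (funext fun i => ?_)
      have h1 : f ((T ^ (i : ℕ)) (T x)) = 0 := by
        rw [← pow_succ_apply]
        by_cases hi : (i : ℕ) + 1 < p + 1
        · exact congrFun (LinearMap.mem_ker.1 hx) ⟨i + 1, hi⟩
        · exact hf0' _ (by omega) x
      exact h1
    · rintro _ ⟨c, rfl⟩
      rw [hJ, map_sum]
      refine sum_mem fun i _ => ?_
      rw [map_smul, ← pow_succ_apply']
      exact Submodule.smul_mem _ _ (hmem _)
    · constructor
      · rw [Submodule.disjoint_def]
        rintro _ h1 ⟨c, rfl⟩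
        have : c = 0 := hinj (by rw [map_zero]; exact h1)
        rw [this, map_zero]
      · rw [codisjoint_iff, eq_top_iff]
        rintro x -
        obtain ⟨c, hc⟩ := hsurj (Φ x)
        have hc' : Φ (J c) = Φ x := hc
        refine Submodule.mem_sup.2 ⟨x - J c, ?_, J c, ⟨c, rfl⟩, sub_add_cancel _ _⟩
        rw [LinearMap.mem_ker, map_sub, sub_eq_zero]
        exact hc'.symm
  refine ⟨_, _, hr, inferInstance, ?_, ?_⟩
  · ext ⟨_, c, rfl⟩
    rw [coe_restrict_pow_apply]
    change (T ^ (p + 1)) (J c) = 0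
    rw [hJ, map_sum]
    refine Finset.sum_eq_zero fun i _ => ?_
    rw [map_smul, ← pow_add_apply, hu' _ (by omega), smul_zero]
  · intro h0
    have h1 := coe_restrict_pow_apply hr.map_right p ⟨u, hmem 0⟩
    rw [h0] at h1
    have h2 : (T ^ p) u = 0 := h1.symm
    exact hnot (h2 ▸ zero_mem _)

/-- An operator splits off a nilpotent one of degree `dis T` on a finite-dimensional space as soon
as `R(T ^ dis T)` is closed. -/
theorem exists_isReducedBy_of_dis_eq {d : ℕ} (h : dis T = d)
    (hcl : IsClosed (rangePow T d : Set X)) :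
    ∃ (M N : Submodule ℂ X) (hr : IsReducedBy T M N), FiniteDimensional ℂ N ∧
      ∀ n, (T.restrict hr.map_right) ^ n = 0 ↔ d ≤ n := by
  rcases d with _ | p
  · refine ⟨⊤, ⊥, ⟨isClosed_univ, isClosed_singleton, fun _ _ => trivial, ?_, isCompl_top_bot⟩,
      inferInstance, fun n => ⟨fun _ => n.zero_le, fun _ => ?_⟩⟩
    · rintro x hx
      rw [Submodule.mem_bot] at hx ⊢
      rw [hx, map_zero]
    · exact ContinuousLinearMap.ext fun _ => Subsingleton.elim _ _
  · obtain ⟨M, N, hr, hfin, h1, h2⟩ := exists_isReducedBy_of_dis_eq_succ h hcl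
    refine ⟨M, N, hr, hfin, fun n => ⟨fun hn => ?_, fun hn => pow_eq_zero_of_le hn h1⟩⟩
    by_contra! hlt
    exact h2 (pow_eq_zero_of_le (Nat.le_of_lt_succ hlt) hn)

end

/-! ### Direct sums of operators -/

section

variable {X E F : Type*} [NormedAddCommGroup X] [NormedSpace ℂ X]
  [NormedAddCommGroup E] [NormedSpace ℂ E] [NormedAddCommGroup F] [NormedSpace ℂ F]

/-- Under the isomorphism `e : E × F ≃ X` the operator `T` on `X` is the direct sum of `A` on `E`
and `B` on `F`. -/
def IsDirectSum (e : (E × F) ≃L[ℂ] X) (T : X →L[ℂ] X) (A : E →L[ℂ] E) (B : F →L[ℂ] F) : Prop :=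
  ∀ x y, T (e (x, y)) = e (A x, B y)

namespace IsDirectSum

variable {e : (E × F) ≃L[ℂ] X} {T : X →L[ℂ] X} {A : E →L[ℂ] E} {B : F →L[ℂ] F}

theorem pow_apply (h : IsDirectSum e T A B) (n : ℕ) (x : E) (y : F) :
    (T ^ n) (e (x, y)) = e ((A ^ n) x, (B ^ n) y) := by
  induction n with
  | zero => rfl
  | succ n ih => rw [pow_succ_apply', ih, h, pow_succ_apply', pow_succ_apply']

theorem mem_rangePow_iff (h : IsDirectSum e T A B) {n : ℕ} {x : E} {y : F} :
    e (x, y) ∈ rangePow T n ↔ x ∈ rangePow A n ∧ y ∈ rangePow B n := by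
  constructor
  · rintro ⟨z, hz⟩
    obtain ⟨⟨x', y'⟩, rfl⟩ := e.surjective z
    have := e.injective ((h.pow_apply n x' y').symm.trans hz)
    rw [Prod.mk.injEq] at this
    exact ⟨⟨x', this.1⟩, ⟨y', this.2⟩⟩
  · rintro ⟨⟨x', rfl⟩, ⟨y', rfl⟩⟩
    exact ⟨e (x', y'), h.pow_apply n x' y'⟩

theorem apply_eq_zero_iff (h : IsDirectSum e T A B) {x : E} {y : F} :
    T (e (x, y)) = 0 ↔ A x = 0 ∧ B y = 0 := by
  rw [h, EmbeddingLike.map_eq_zero_iff, Prod.mk_eq_zero]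

theorem mem_kerRestrPow_iff (h : IsDirectSum e T A B) {n : ℕ} {x : E} {y : F} :
    e (x, y) ∈ kerRestrPow T n ↔ x ∈ kerRestrPow A n ∧ y ∈ kerRestrPow B n := by
  rw [mem_kerRestrPow, mem_kerRestrPow, mem_kerRestrPow, h.mem_rangePow_iff, h.apply_eq_zero_iff]
  tauto

theorem stableFrom_iff (h : IsDirectSum e T A B) {n : ℕ} :
    StableFrom T n ↔ StableFrom A n ∧ StableFrom B n := by
  constructor
  · refine fun hT => ⟨fun r hr => ?_, fun r hr => ?_⟩
    · ext x
      have h1 : e (x, 0) ∈ kerRestrPow T n ↔ e (x, 0) ∈ kerRestrPow T r := by rw [hT r hr]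
      simpa [h.mem_kerRestrPow_iff] using h1
    · ext y
      have h1 : e (0, y) ∈ kerRestrPow T n ↔ e (0, y) ∈ kerRestrPow T r := by rw [hT r hr]
      simpa [h.mem_kerRestrPow_iff] using h1
  · rintro ⟨hA, hB⟩ r hr
    ext z
    obtain ⟨⟨x, y⟩, rfl⟩ := e.surjective z
    rw [h.mem_kerRestrPow_iff, h.mem_kerRestrPow_iff, hA r hr, hB r hr]

/-- The isomorphism of `R(Aⁿ) × R(Bⁿ)` with `R(Tⁿ)`. -/
noncomputable def rangePowEquiv (h : IsDirectSum e T A B) (n : ℕ) :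
    (rangePow A n × rangePow B n) ≃ₗ[ℂ] rangePow T n :=
  LinearEquiv.ofBijective
    (LinearMap.codRestrict (rangePow T n)
      (e.toLinearEquiv.toLinearMap ∘ₗ (rangePow A n).subtype.prodMap (rangePow B n).subtype)
      (fun z => h.mem_rangePow_iff.2 ⟨z.1.2, z.2.2⟩))
    (by
      constructor
      · rintro ⟨x, y⟩ ⟨x', y'⟩ hxy
        have := e.injective (congrArg Subtype.val hxy)
        rw [Prod.mk.injEq] at this
        exact Prod.ext (Subtype.ext this.1) (Subtype.ext this.2)
      · rintro ⟨z, hz⟩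
        obtain ⟨⟨x, y⟩, rfl⟩ := e.surjective z
        have hxy := h.mem_rangePow_iff.1 hz
        exact ⟨(⟨x, hxy.1⟩, ⟨y, hxy.2⟩), rfl⟩)

theorem restrPow_rangePowEquiv (h : IsDirectSum e T A B) (n : ℕ) (x : rangePow A n)
    (y : rangePow B n) :
    restrPow T n (h.rangePowEquiv n (x, y)) =
      h.rangePowEquiv n (restrPow A n x, restrPow B n y) :=
  Subtype.ext (h x y)

theorem nullity_restrPow (h : IsDirectSum e T A B) (n : ℕ) :
    nullity (restrPow T n) = nullity (restrPow A n) + nullity (restrPow B n) :=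
  eDim_ker_of_prod _ _ _ (h.rangePowEquiv n) (h.restrPow_rangePowEquiv n)

theorem defect_restrPow (h : IsDirectSum e T A B) (n : ℕ) :
    defect (restrPow T n) = defect (restrPow A n) + defect (restrPow B n) :=
  eDim_quotient_range_of_prod _ _ _ (h.rangePowEquiv n) (h.restrPow_rangePowEquiv n)

theorem isClosed_rangePow (h : IsDirectSum e T A B) {n : ℕ}
    (hcl : IsClosed (rangePow T n : Set X)) : IsClosed (rangePow A n : Set E) := by
  have : (rangePow A n : Set E) = (fun x : E => e (x, 0)) ⁻¹' (rangePow T n : Set X) := by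
    ext x
    have := h.mem_rangePow_iff (n := n) (x := x) (y := 0)
    simp only [zero_mem, and_true] at this
    exact this.symm
  rw [this]
  exact hcl.preimage (e.continuous.comp (by fun_prop))

end IsDirectSum

/-! ### Nilpotent operators on finite-dimensional spaces -/

/-- For a nilpotent operator the degree of stable iteration is the degree of nilpotency. -/
theorem stableFrom_iff_pow_eq_zero {B : F →L[ℂ] F} (hB : IsNilpotent B) {n : ℕ} :
    StableFrom B n ↔ B ^ n = 0 := by
  obtain ⟨p, hp⟩ := hB
  have hbot (r : ℕ) (hr : B ^ r = 0) : rangePow B r = ⊥ := by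
    rw [rangePow, hr]
    exact LinearMap.range_zero
  have hbot' (r : ℕ) (hr : B ^ r = 0) : kerRestrPow B r = ⊥ := by
    rw [kerRestrPow_eq, hbot r hr, inf_bot_eq]
  constructor
  · intro h
    by_contra hn
    have hker : kerRestrPow B n = ⊥ := by
      rw [h (n + p) (by omega), hbot' _ (pow_eq_zero_of_le (by omega) hp)]
    have hstep (k : ℕ) (hk : n ≤ k) (h0 : B ^ (k + 1) = 0) : B ^ k = 0 := by
      ext x
      have h1 : (B ^ k) x ∈ kerRestrPow B n := by
        refine (mem_kerRestrPow B).2 ⟨?_, rangePow_antitone B hk ⟨x, rfl⟩⟩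
        rw [← pow_succ_apply', h0]
        rfl
      rw [hker] at h1
      exact h1
    have hall (j : ℕ) : B ^ (n + j) = 0 → B ^ n = 0 := by
      induction j with
      | zero => exact id
      | succ j ih => exact fun h0 => ih (hstep _ (by omega) h0)
    exact hn (hall p (pow_eq_zero_of_le (by omega) hp))
  · intro h r hr
    rw [hbot' n h, hbot' r (pow_eq_zero_of_le hr h)]

theorem nullity_restrPow_eq_defect [FiniteDimensional ℂ F] (B : F →L[ℂ] F) (n : ℕ) :
    nullity (restrPow B n) = defect (restrPow B n) :=
  eDim_ker_eq_eDim_quotient_range _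

theorem nullity_restrPow_lt_top [FiniteDimensional ℂ F] (B : F →L[ℂ] F) (n : ℕ) :
    nullity (restrPow B n) < ⊤ := by
  rw [nullity_restrPow, eDim_lt_top]
  infer_instance

theorem nullity_restrPow_ne_zero {B : F →L[ℂ] F} (hB : IsNilpotent B) {n : ℕ} (hn : B ^ n ≠ 0) :
    nullity (restrPow B n) ≠ 0 := by
  rw [nullity_restrPow, Ne, eDim_eq_zero, Submodule.subsingleton_iff_eq_bot]
  refine fun h => hn ((stableFrom_iff_pow_eq_zero hB).1 fun r hr => ?_)
  exact h.trans (le_bot_iff.1 ((kerRestrPow_antitone B hr).trans h.le)).symm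

/-! ### Finite-dimensional summands -/

theorem _root_.EReal.add_coe_sub_add_coe (x y : EReal) (r : ℝ) : (x + r) - (y + r) = x - y := by
  induction x <;> induction y <;>
    simp only [← EReal.coe_add, ← EReal.coe_sub, EReal.bot_add, EReal.top_add_coe,
      EReal.bot_sub, EReal.top_sub_coe, EReal.coe_sub_bot, EReal.sub_top, add_sub_add_right_eq_sub]

namespace IsDirectSum

variable {e : (E × F) ≃L[ℂ] X} {T : X →L[ℂ] X} {A : E →L[ℂ] E} {B : F →L[ℂ] F}
  [FiniteDimensional ℂ F]

theorem nullity_lt_top_iff (h : IsDirectSum e T A B) (n : ℕ) :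
    nullity (restrPow T n) < ⊤ ↔ nullity (restrPow A n) < ⊤ := by
  rw [h.nullity_restrPow, ENat.add_lt_top]
  exact and_iff_left (nullity_restrPow_lt_top B n)

theorem defect_lt_top_iff (h : IsDirectSum e T A B) (n : ℕ) :
    defect (restrPow T n) < ⊤ ↔ defect (restrPow A n) < ⊤ := by
  rw [h.defect_restrPow, ENat.add_lt_top]
  exact and_iff_left (nullity_restrPow_eq_defect B n ▸ nullity_restrPow_lt_top B n)

theorem essAscent_eq (h : IsDirectSum e T A B) : essAscent T = essAscent A := by
  simp only [essAscent, h.nullity_lt_top_iff]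

theorem essDescent_eq (h : IsDirectSum e T A B) : essDescent T = essDescent A := by
  simp only [essDescent, h.defect_lt_top_iff]

theorem essDegree_eq (h : IsDirectSum e T A B) : essDegree T = essDegree A := by
  simp only [essDegree, min_lt_iff, h.nullity_lt_top_iff, h.defect_lt_top_iff]

theorem isSemiBFredholm (h : IsDirectSum e T A B) (hT : IsSemiBFredholm T) :
    IsSemiBFredholm A := by
  rcases hT with ⟨a, ha, hcl⟩ | ⟨b, hb, hcl⟩
  · exact .inl ⟨a, h.essAscent_eq ▸ ha, h.isClosed_rangePow hcl⟩
  · exact .inr ⟨b, h.essDescent_eq ▸ hb, h.isClosed_rangePow hcl⟩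

/-- By rank-nullity the finite-dimensional summand contributes equally to nullity and defect. -/
theorem min_nullity_defect (h : IsDirectSum e T A B) (n : ℕ) :
    min (nullity (restrPow T n)) (defect (restrPow T n)) =
      min (nullity (restrPow A n)) (defect (restrPow A n)) + nullity (restrPow B n) := by
  rw [h.nullity_restrPow, h.defect_restrPow, ← nullity_restrPow_eq_defect B, min_add_add_right]

theorem index_eq (h : IsDirectSum e T A B) : index T = index A := by
  rw [index, index, h.essDegree_eq, h.nullity_restrPow, h.defect_restrPow,
    ← nullity_restrPow_eq_defect B]
  obtain ⟨k, hk⟩ := ENat.ne_top_iff_exists.1 (nullity_restrPow_lt_top B (essDegree A).toNat).ne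
  rw [← hk, ENat.toENNReal_add, ENat.toENNReal_add, EReal.coe_ennreal_add, EReal.coe_ennreal_add,
    ENat.toENNReal_coe, ← EReal.coe_ennreal_toReal (ENNReal.natCast_ne_top k)]
  exact EReal.add_coe_sub_add_coe _ _ _

end IsDirectSum

theorem IsReducedBy.isDirectSum [CompleteSpace X] {T : X →L[ℂ] X} {M N : Submodule ℂ X}
    (h : IsReducedBy T M N) :
    ∃ e : (M × N) ≃L[ℂ] X, IsDirectSum e T (T.restrict h.map_left) (T.restrict h.map_right) := by
  let e := Submodule.prodEquivOfIsTopCompl M N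
    (Submodule.IsCompl.isTopCompl_of_isClosed h.isCompl h.isClosed_left h.isClosed_right)
  have he (z : M × N) : e z = z.1 + z.2 := Submodule.prodEquivOfIsTopCompl_apply _ z
  refine ⟨e, fun x y => ?_⟩
  rw [he, he, map_add]
  rfl

/-- The two summands of a direct sum, as subspaces of the sum. -/
theorem IsDirectSum.exists_isReducedBy {e : (E × F) ≃L[ℂ] X} {T : X →L[ℂ] X} {A : E →L[ℂ] E}
    {B : F →L[ℂ] F} (h : IsDirectSum e T A B) [FiniteDimensional ℂ F] :
    ∃ (M N : Submodule ℂ X) (hr : IsReducedBy T M N), FiniteDimensional ℂ N ∧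
      (∀ n, (T.restrict hr.map_right) ^ n = 0 ↔ B ^ n = 0) ∧
      ∀ n, StableFrom (T.restrict hr.map_left) n ↔ StableFrom A n := by
  let i : E →ₗ[ℂ] X := e.toLinearEquiv.toLinearMap ∘ₗ LinearMap.inl ℂ E F
  let j : F →ₗ[ℂ] X := e.toLinearEquiv.toLinearMap ∘ₗ LinearMap.inr ℂ E F
  have hi (x : E) : i x = e (x, 0) := rfl
  have hj (y : F) : j y = e (0, y) := rfl
  have hTi (n : ℕ) (x : E) : (T ^ n) (i x) = i ((A ^ n) x) := by
    rw [hi, h.pow_apply, map_zero, ← hi]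
  have hTj (n : ℕ) (y : F) : (T ^ n) (j y) = j ((B ^ n) y) := by
    rw [hj, h.pow_apply, map_zero, ← hj]
  have hii : Function.Injective i := e.injective.comp LinearMap.inl_injective
  have hji : Function.Injective j := e.injective.comp LinearMap.inr_injective
  have hr : IsReducedBy T (LinearMap.range i) (LinearMap.range j) := by
    refine ⟨?_, Submodule.closed_of_finiteDimensional _, ?_, ?_, ?_⟩
    · have : (LinearMap.range i : Set X) = (fun z => (e.symm z).2) ⁻¹' {0} := by
        ext z
        obtain ⟨⟨x, y⟩, rfl⟩ := e.surjective z
        simp only [Set.mem_preimage, ContinuousLinearEquiv.symm_apply_apply,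
          Set.mem_singleton_iff]
        constructor
        · rintro ⟨x', hx'⟩
          have := e.injective hx'
          rw [LinearMap.inl_apply, Prod.mk.injEq] at this
          exact this.2.symm
        · rintro rfl
          exact ⟨x, rfl⟩
      rw [this]
      exact isClosed_singleton.preimage (by fun_prop)
    · rintro _ ⟨x, rfl⟩
      exact ⟨A x, (by simpa using (hTi 1 x).symm)⟩
    · rintro _ ⟨y, rfl⟩
      exact ⟨B y, (by simpa using (hTj 1 y).symm)⟩
    · rw [LinearMap.range_comp, LinearMap.range_comp]
      exact LinearMap.isCompl_range_inl_inr.map (Submodule.orderIsoMapComap e.toLinearEquiv)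
  refine ⟨_, _, hr, inferInstance, fun n => ?_, fun n => ?_⟩
  · have key (y : F) : (((T.restrict hr.map_right) ^ n) ⟨j y, y, rfl⟩ : X) = j ((B ^ n) y) :=
      (coe_restrict_pow_apply hr.map_right n _).trans (hTj n y)
    constructor
    · intro h0
      ext y
      refine hji ?_
      rw [← key, h0]
      exact (map_zero j).symm
    · intro h0
      ext ⟨_, y, rfl⟩
      rw [key, h0]
      exact map_zero j
  · have key (r : ℕ) (x : E) : (⟨i x, x, rfl⟩ : LinearMap.range i) ∈
        kerRestrPow (T.restrict hr.map_left) r ↔ x ∈ kerRestrPow A r := by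
      rw [mem_kerRestrPow, mem_kerRestrPow]
      refine and_congr ?_ ?_
      · rw [Subtype.ext_iff]
        change T (i x) = 0 ↔ _
        have := hTi 1 x
        rw [pow_one, pow_one] at this
        rw [this, map_eq_zero_iff i hii]
      · constructor
        · rintro ⟨⟨_, x', rfl⟩, hx'⟩
          refine ⟨x', hii ?_⟩
          have := congrArg Subtype.val hx'
          exact (hTi r x').symm.trans ((coe_restrict_pow_apply hr.map_left _ _).symm.trans this)
        · rintro ⟨x', rfl⟩
          exact ⟨⟨i x', x', rfl⟩, Subtype.ext
            ((coe_restrict_pow_apply hr.map_left _ _).trans (hTi r x'))⟩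
    refine forall₂_congr fun r _ => ?_
    rw [SetLike.ext_iff, SetLike.ext_iff]
    constructor
    · intro h1 x
      rw [← key, ← key, h1]
    · rintro h1 ⟨_, x, rfl⟩
      rw [key, key, h1]

end

/-! ### Reduction to stable iteration from the essential degree on -/

theorem IsDirectSum.assoc {X E E' F F' : Type*} [NormedAddCommGroup X] [NormedSpace ℂ X]
    [NormedAddCommGroup E] [NormedSpace ℂ E] [NormedAddCommGroup F] [NormedSpace ℂ F]
    [NormedAddCommGroup E'] [NormedSpace ℂ E'] [NormedAddCommGroup F'] [NormedSpace ℂ F']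
    {e : (E × F) ≃L[ℂ] X} {T : X →L[ℂ] X} {A : E →L[ℂ] E} {B : F →L[ℂ] F}
    {e' : (E' × F') ≃L[ℂ] E} {A' : E' →L[ℂ] E'} {B' : F' →L[ℂ] F'}
    (h : IsDirectSum e T A B) (h' : IsDirectSum e' A A' B') :
    IsDirectSum (((ContinuousLinearEquiv.prodAssoc ℂ E' F' F).symm.trans
      (e'.prodCongr (ContinuousLinearEquiv.refl ℂ F))).trans e) T A' (B'.prodMap B) := by
  rintro x ⟨y, z⟩
  change T (e (e' (x, y), z)) = e (e' (A' x, B' y), B z)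
  rw [h, h']

/-- By induction on `min (α(T_[m])) (β(T_[m]))`: while `T` is not stable from `m` on, its maximal
Jordan block has size greater than `m`, so splitting it off lowers this number. -/
theorem exists_isReducedBy_stableFrom.{u} (k : ℕ) {X : Type u} [NormedAddCommGroup X]
    [NormedSpace ℂ X] [CompleteSpace X] (T : X →L[ℂ] X) {m d : ℕ} (hd : dis T = d)
    (hcl : ∀ n, m ≤ n → IsClosed (rangePow T n : Set X)) (hmd : m ≤ d)
    (hk : min (nullity (restrPow T m)) (defect (restrPow T m)) = k) :
    ∃ (M N : Submodule ℂ X) (hr : IsReducedBy T M N), FiniteDimensional ℂ N ∧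
      (∀ n, (T.restrict hr.map_right) ^ n = 0 ↔ d ≤ n) ∧
      StableFrom (T.restrict hr.map_left) m := by
  induction k using Nat.strong_induction_on generalizing X d with
  | _ k ih =>
    obtain ⟨M, N, hr, hfin, hN⟩ := exists_isReducedBy_of_dis_eq hd (hcl d hmd)
    by_cases hst : StableFrom (T.restrict hr.map_left) m
    · exact ⟨M, N, hr, hfin, hN, hst⟩
    have := hr.isClosed_left.completeSpace_coe
    obtain ⟨e, he⟩ := hr.isDirectSum
    set A := T.restrict hr.map_left
    set B := T.restrict hr.map_right
    have hdA : StableFrom A d := (he.stableFrom_iff.1 (dis_eq_natCast_iff.1 hd).1).1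
    have hB : IsNilpotent B := ⟨d, (hN d).2 le_rfl⟩
    have hBm : B ^ m ≠ 0 := fun h0 => hst (hdA.mono ((hN m).1 h0))
    have hmin := he.min_nullity_defect m
    rw [hk] at hmin
    have hne := nullity_restrPow_ne_zero hB hBm
    have hAfin : min (nullity (restrPow A m)) (defect (restrPow A m)) < ⊤ :=
      (le_self_add.trans hmin.ge).trans_lt (ENat.natCast_lt_top k)
    obtain ⟨k', hk'⟩ := ENat.ne_top_iff_exists.1 hAfin.ne
    have hlt : k' < k := by
      obtain ⟨l, hl⟩ := ENat.ne_top_iff_exists.1 (nullity_restrPow_lt_top B m).ne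
      rw [← hk', ← hl] at hmin
      rw [← hl] at hne
      have h1 : k = k' + l := by exact_mod_cast hmin
      have h2 : l ≠ 0 := by exact_mod_cast hne
      omega
    obtain ⟨d', hd'⟩ := exists_dis_eq hAfin
    obtain ⟨hd'1, hd'2⟩ := dis_eq_natCast_iff.1 hd'
    have hmd' : m ≤ d' := by
      by_contra! hlt'
      exact hst (hd'1.mono hlt'.le)
    obtain ⟨M', N', hr', hfin', hN', hst'⟩ := ih k' hlt A hd'
      (fun n hn => he.isClosed_rangePow (hcl n hn)) hmd' hk'.symm
    obtain ⟨e', he'⟩ := hr'.isDirectSum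
    obtain ⟨M₂, N₂, hr₂, hfin₂, hN₂, hst₂⟩ := (he.assoc he').exists_isReducedBy
    refine ⟨M₂, N₂, hr₂, hfin₂, fun n => ?_, (hst₂ m).2 hst'⟩
    rw [hN₂, ← hN n]
    set B' := A.restrict hr'.map_right
    have hpow (x : N') (y : N) : ((B'.prodMap B) ^ n) (x, y) = ((B' ^ n) x, (B ^ n) y) := by
      induction n with
      | zero => rfl
      | succ n ih => rw [pow_succ_apply', pow_succ_apply', pow_succ_apply', ih]; rfl
    constructor
    · intro h0
      refine ContinuousLinearMap.ext fun y => ?_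
      have := hpow 0 y
      rw [h0] at this
      exact (congrArg Prod.snd this).symm
    · intro h0
      have h0' : B' ^ n = 0 := (hN' n).2 ((hd'2 d hdA).trans ((hN n).1 h0))
      refine ContinuousLinearMap.ext fun z => ?_
      exact (hpow z.1 z.2).trans (by rw [h0, h0']; rfl)

/-! ### Perturbation of surjective operators and of operators bounded below -/

section Perturbation

open Filter Topology

/-- A property that is locally constant on an open disc about `0` is constant there. -/
theorem iff_of_eventually_iff {P : ℂ → Prop} {r : ℝ}
    (h : ∀ z, ‖z‖ < r → ∀ᶠ w in 𝓝 (0 : ℂ), P (z + w) ↔ P z) {z : ℂ} (hz : ‖z‖ < r) :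
    P z ↔ P 0 := by
  classical
  have hcont : ContinuousOn (fun z => decide (P z)) (Metric.ball 0 r) := by
    intro z hz
    refine ContinuousAt.continuousWithinAt ?_
    have h1 := h z (by simpa using hz)
    have h2 : Tendsto (fun w => w - z) (𝓝 z) (𝓝 0) := by
      have : Continuous fun w : ℂ => w - z := by fun_prop
      simpa using this.tendsto z
    refine (tendsto_const_nhds (x := decide (P z))).congr' ?_
    filter_upwards [h2.eventually h1] with w hw
    rw [add_sub_cancel] at hw
    exact decide_eq_decide.2 hw.symm
  have h0 : (0 : ℂ) ∈ Metric.ball (0 : ℂ) r :=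
    Metric.mem_ball_self ((norm_nonneg z).trans_lt hz)
  exact decide_eq_decide.1 ((convex_ball (0 : ℂ) r).isPreconnected.constant hcont
    (by simpa using hz) h0)

section

variable {E F : Type*} [NormedAddCommGroup E] [NormedSpace ℂ E] [NormedAddCommGroup F]
  [NormedSpace ℂ F]

/-- Successive approximation: approximate solutions of `g x = y` with relative error `q < 1` and
controlled norm can be summed up to exact solutions with controlled norm. -/
theorem exists_preimage_of_approx [CompleteSpace E] (g : E →L[ℂ] F) {C q : ℝ} (hC : 0 ≤ C)
    (hq0 : 0 ≤ q) (hq : q < 1)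
    (h : ∀ y, ∃ x, ‖y - g x‖ ≤ q * ‖y‖ ∧ ‖x‖ ≤ C * ‖y‖) (y : F) :
    ∃ x, g x = y ∧ ‖x‖ ≤ C / (1 - q) * ‖y‖ := by
  choose s hs1 hs2 using h
  let v : ℕ → F := fun n => (fun y => y - g (s y))^[n] y
  have hv (n : ℕ) : v (n + 1) = v n - g (s (v n)) := Function.iterate_succ_apply' _ _ _
  have hvn (n : ℕ) : ‖v n‖ ≤ q ^ n * ‖y‖ := by
    induction n with
    | zero => simp [v]
    | succ n ih =>
      rw [hv, pow_succ', mul_assoc]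
      exact (hs1 _).trans (mul_le_mul_of_nonneg_left ih hq0)
  have hsn (n : ℕ) : ‖s (v n)‖ ≤ C * ‖y‖ * q ^ n := by
    calc ‖s (v n)‖ ≤ C * ‖v n‖ := hs2 _
      _ ≤ C * (q ^ n * ‖y‖) := mul_le_mul_of_nonneg_left (hvn n) hC
      _ = C * ‖y‖ * q ^ n := by ring
  have hgeo := (hasSum_geometric_of_lt_one hq0 hq).mul_left (C * ‖y‖)
  have hsum : Summable fun n => s (v n) := Summable.of_norm_bounded hgeo.summable hsn
  refine ⟨∑' n, s (v n), ?_, ?_⟩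
  · have h1 : Tendsto (fun n => ∑ i ∈ Finset.range n, g (s (v i))) atTop
        (𝓝 (g (∑' n, s (v n)))) := by
      have := (g.continuous.tendsto _).comp hsum.hasSum.tendsto_sum_nat
      simpa only [Function.comp_def, map_sum] using this
    have h2 (n : ℕ) : ∑ i ∈ Finset.range n, g (s (v i)) = y - v n := by
      induction n with
      | zero => simp [v]
      | succ n ih => rw [Finset.sum_range_succ, ih, hv]; abel
    have h3 : Tendsto v atTop (𝓝 0) := by
      refine squeeze_zero_norm hvn ?_
      simpa using (tendsto_pow_atTop_nhds_zero_of_lt_one hq0 hq).mul_const ‖y‖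
    have h4 : Tendsto (fun n => y - v n) atTop (𝓝 y) := by
      simpa using tendsto_const_nhds.sub h3
    simp only [h2] at h1
    exact tendsto_nhds_unique h1 h4
  · refine (tsum_of_norm_bounded hgeo hsn).trans_eq ?_
    field_simp

theorem exists_preimage_sub_smul [CompleteSpace E] (A : E →L[ℂ] E) {C : ℝ} (hC : 0 ≤ C)
    (h : ∀ y, ∃ x, A x = y ∧ ‖x‖ ≤ C * ‖y‖) {z : ℂ} (hz : ‖z‖ * C < 1) (y : E) :
    ∃ x, (A - z • ContinuousLinearMap.id ℂ E) x = y ∧ ‖x‖ ≤ C / (1 - ‖z‖ * C) * ‖y‖ := by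
  refine exists_preimage_of_approx _ hC (by positivity) hz (fun y => ?_) y
  obtain ⟨x, rfl, hx⟩ := h y
  refine ⟨x, ?_, hx⟩
  have : A x - (A - z • ContinuousLinearMap.id ℂ E) x = z • x := by simp
  rw [this, norm_smul, mul_assoc]
  gcongr

/-- With a right inverse `B` one has `A - w = A (1 - w B)`. -/
theorem nullity_sub_smul_of_bijective {A B : E →L[ℂ] E} {w : ℂ} (hAB : A * B = 1)
    (hu : Function.Bijective (1 - w • B : E →L[ℂ] E)) :
    nullity (A - w • ContinuousLinearMap.id ℂ E) = nullity A := by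
  let U := LinearEquiv.ofBijective (1 - w • B : E →L[ℂ] E).toLinearMap hu
  have h1 (x : E) : (A - w • ContinuousLinearMap.id ℂ E) x = A (U x) := by
    have h2 : A (B x) = x := congrArg (fun S : E →L[ℂ] E => S x) hAB
    change A x - w • x = A (x - w • B x)
    rw [map_sub, map_smul, h2]
  have h2 : (LinearMap.ker ((A - w • ContinuousLinearMap.id ℂ E : E →L[ℂ] E) : E →ₗ[ℂ] E)).map
      U.toLinearMap = LinearMap.ker (A : E →ₗ[ℂ] E) := by
    ext y
    constructor
    · rintro ⟨x, hx, rfl⟩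
      exact (h1 x).symm.trans hx
    · intro hy
      obtain ⟨x, rfl⟩ := U.surjective y
      exact ⟨x, (h1 x).trans hy, rfl⟩
  exact eDim_congr ((U.submoduleMap _).trans (LinearEquiv.ofEq _ _ h2))

/-- With a left inverse `B` one has `A - w = (1 - w B) A`. -/
theorem defect_sub_smul_of_bijective {A B : E →L[ℂ] E} {w : ℂ} (hBA : B * A = 1)
    (hu : Function.Bijective (1 - w • B : E →L[ℂ] E)) :
    defect (A - w • ContinuousLinearMap.id ℂ E) = defect A := by
  let U := LinearEquiv.ofBijective (1 - w • B : E →L[ℂ] E).toLinearMap hu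
  have h1 (x : E) : (A - w • ContinuousLinearMap.id ℂ E) x = U (A x) := by
    have h2 : B (A x) = x := congrArg (fun S : E →L[ℂ] E => S x) hBA
    change A x - w • x = A x - w • B (A x)
    rw [h2]
  have h2 : (LinearMap.range (A : E →ₗ[ℂ] E)).map U.toLinearMap =
      LinearMap.range ((A - w • ContinuousLinearMap.id ℂ E : E →L[ℂ] E) : E →ₗ[ℂ] E) := by
    ext y
    constructor
    · rintro ⟨_, ⟨x, rfl⟩, rfl⟩
      exact ⟨x, h1 x⟩
    · rintro ⟨x, rfl⟩
      exact ⟨A x, ⟨x, rfl⟩, (h1 x).symm⟩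
  exact (eDim_congr (Submodule.Quotient.equiv _ _ U h2)).symm

theorem eventually_bijective_one_sub_smul [CompleteSpace E] (B : E →L[ℂ] E) :
    ∀ᶠ w in 𝓝 (0 : ℂ), Function.Bijective (1 - w • B : E →L[ℂ] E) := by
  have h : Tendsto (fun w : ℂ => ‖w • B‖) (𝓝 0) (𝓝 0) := by
    have : Continuous fun w : ℂ => ‖w • B‖ := by fun_prop
    simpa using this.tendsto 0
  filter_upwards [h.eventually (gt_mem_nhds one_pos)] with w hw
  exact ContinuousLinearMap.isUnit_iff_bijective.1 (isUnit_one_sub_of_norm_lt_one hw)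

theorem exists_rightInverse_of_nullity_lt_top [CompleteSpace E] {A : E →L[ℂ] E}
    (hA : Function.Surjective A) (hfin : nullity A < ⊤) : ∃ B : E →L[ℂ] E, A * B = 1 := by
  have : FiniteDimensional ℂ (LinearMap.ker (A : E →ₗ[ℂ] E)) := eDim_lt_top.1 hfin
  obtain ⟨p, hp⟩ := Submodule.ClosedComplemented.of_finiteDimensional
    (LinearMap.ker (A : E →ₗ[ℂ] E))
  have hps : Function.Surjective p := fun x => ⟨x, hp x⟩
  let e := ContinuousLinearMap.equivProdOfSurjectiveOfIsCompl A p
    (LinearMap.range_eq_top.2 hA) (LinearMap.range_eq_top.2 hps) (LinearMap.isCompl_of_proj hp)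
  refine ⟨e.symm.toContinuousLinearMap ∘L ContinuousLinearMap.inl ℂ E _, ?_⟩
  ext y
  exact congrArg Prod.fst (e.apply_symm_apply (y, 0))

theorem exists_leftInverse_of_defect_lt_top [CompleteSpace E] {A : E →L[ℂ] E}
    (hA : Function.Injective A) (hfin : defect A < ⊤) : ∃ B : E →L[ℂ] E, B * A = 1 := by
  have : FiniteDimensional ℂ (E ⧸ LinearMap.range (A : E →ₗ[ℂ] E)) := eDim_lt_top.1 hfin
  have hcl := isClosed_range_of_finiteDimensional_quotient A
  open ContinuousLinearMap.HasLeftInverse in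
  obtain ⟨B, hB⟩ := of_injective_of_isClosed_range_of_closedComplement_range hA hcl
    (Submodule.ClosedComplemented.of_finiteDimensional_quotient hcl)
  exact ⟨B, ContinuousLinearMap.ext hB⟩

/-- Linearly independent vectors of the kernel of a surjective operator can be moved slightly into
the kernels of its small perturbations. -/
theorem eventually_natCast_le_nullity [CompleteSpace E] (A : E →L[ℂ] E) {C : ℝ} (hC : 0 < C)
    (h : ∀ y, ∃ x, A x = y ∧ ‖x‖ ≤ C * ‖y‖) {n : ℕ} (hn : (n : ℕ∞) ≤ nullity A) :
    ∀ᶠ w in 𝓝 (0 : ℂ), (n : ℕ∞) ≤ nullity (A - w • ContinuousLinearMap.id ℂ E) := by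
  obtain ⟨v, hv⟩ := natCast_le_eDim.1 hn
  have hv' : LinearIndependent ℂ fun i => (v i : E) :=
    hv.map' (LinearMap.ker (A : E →ₗ[ℂ] E)).subtype (Submodule.ker_subtype _)
  obtain ⟨ε, hε, hball⟩ := Metric.isOpen_iff.1
    (isOpen_setOfPred_linearIndependent (𝕜 := ℂ) (E := E) (ι := Fin n)) _ hv'
  set V : Fin n → E := fun i => (v i : E)
  have h1 : Tendsto (fun w : ℂ => ‖w‖ * C) (𝓝 0) (𝓝 0) := by
    have : Continuous fun w : ℂ => ‖w‖ * C := by fun_prop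
    simpa using this.tendsto 0
  have h2 : Tendsto (fun w : ℂ => 2 * C * (‖w‖ * ‖V‖)) (𝓝 0) (𝓝 0) := by
    have : Continuous fun w : ℂ => 2 * C * (‖w‖ * ‖V‖) := by fun_prop
    simpa using this.tendsto 0
  filter_upwards [h1.eventually (gt_mem_nhds one_half_pos), h2.eventually (gt_mem_nhds hε)]
    with w hw1 hw2
  choose u hu1 hu2 using fun i => exists_preimage_sub_smul A hC.le h
    (hw1.trans (by norm_num)) (w • V i)
  have hu3 (i : Fin n) : ‖u i‖ < ε := by
    refine (hu2 i).trans_lt (lt_of_le_of_lt ?_ hw2)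
    rw [norm_smul]
    have h3 : C / (1 - ‖w‖ * C) ≤ 2 * C := by
      rw [div_le_iff₀ (by linarith)]
      nlinarith
    have h4 := norm_le_pi_norm V i
    gcongr
  have hmem : (fun i => V i + u i) ∈ {f : Fin n → E | LinearIndependent ℂ f} := by
    refine hball ?_
    rw [Metric.mem_ball, dist_pi_lt_iff hε]
    intro i
    rw [dist_eq_norm, add_sub_cancel_left]
    exact hu3 i
  have hker (i : Fin n) : V i + u i ∈
      LinearMap.ker ((A - w • ContinuousLinearMap.id ℂ E : E →L[ℂ] E) : E →ₗ[ℂ] E) := by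
    have h5 : A (V i) = 0 := (v i).2
    have h6 := hu1 i
    change (A - w • ContinuousLinearMap.id ℂ E) (V i + u i) = 0
    rw [map_add, h6]
    change A (V i) - w • V i + w • V i = 0
    rw [h5]
    abel
  exact natCast_le_eDim.2 ⟨fun i => ⟨_, hker i⟩,
    LinearIndependent.of_comp (Submodule.subtype _) hmem⟩

/-- Linear independence modulo the range of an operator bounded below persists under small
perturbations. -/
theorem eventually_natCast_le_defect [CompleteSpace E] (A : E →L[ℂ] E) {C : ℝ}
    (h : ∀ x, ‖x‖ ≤ C * ‖A x‖) {n : ℕ} (hn : (n : ℕ∞) ≤ defect A) :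
    ∀ᶠ w in 𝓝 (0 : ℂ), (n : ℕ∞) ≤ defect (A - w • ContinuousLinearMap.id ℂ E) := by
  obtain ⟨v, hv⟩ := natCast_le_eDim.1 hn
  choose u hu using fun i => Submodule.mkQ_surjective _ (v i)
  obtain rfl : (fun i => Submodule.mkQ _ (u i)) = v := funext hu
  let J : (Fin n → ℂ) →L[ℂ] E :=
    LinearMap.toContinuousLinearMap (Fintype.linearCombination ℂ u)
  have hJ (c : Fin n → ℂ) : J c = ∑ i, c i • u i := Fintype.linearCombination_apply _ _ _
  have hind : ∀ (B : E →L[ℂ] E), LinearIndependent ℂ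
      (fun i => (LinearMap.range (B : E →ₗ[ℂ] E)).mkQ (u i)) ↔
        ∀ c, J c ∈ LinearMap.range (B : E →ₗ[ℂ] E) → c = 0 := by
    intro B
    rw [Fintype.linearIndependent_iff]
    refine forall_congr' fun c => ?_
    have : ∑ i, c i • (LinearMap.range (B : E →ₗ[ℂ] E)).mkQ (u i) =
        (LinearMap.range (B : E →ₗ[ℂ] E)).mkQ (J c) := by
      rw [hJ, map_sum]
      simp only [map_smul]
    rw [this, Submodule.mkQ_apply, Submodule.Quotient.mk_eq_zero, funext_iff]
    rfl
  have hinjA : Function.Injective A := by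
    rw [injective_iff_map_eq_zero]
    intro x hx
    have := h x
    rw [hx, norm_zero, mul_zero] at this
    exact norm_le_zero_iff.1 this
  let Ψ : (E × (Fin n → ℂ)) →L[ℂ] E := A.coprod J
  have hΨ (p : E × (Fin n → ℂ)) : Ψ p = A p.1 + J p.2 := rfl
  have hΨinj : Function.Injective Ψ := by
    rw [injective_iff_map_eq_zero]
    rintro ⟨x, c⟩ hxc
    rw [hΨ] at hxc
    have hc : c = 0 := (hind A).1 hv c ⟨-x, by
      change A (-x) = J c
      rw [map_neg, neg_eq_iff_add_eq_zero]
      exact hxc⟩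
    subst hc
    have hx : A x = 0 := by simpa using hxc
    rw [(map_eq_zero_iff A hinjA).1 hx]
    rfl
  have hclA : IsClosed (LinearMap.range (A : E →ₗ[ℂ] E) : Set E) := by
    refine (A.isClosed_range_iff_antilipschitz_of_injective hinjA).2 ⟨C.toNNReal, ?_⟩
    refine A.antilipschitz_of_bound fun x => (h x).trans ?_
    gcongr
    exact Real.le_coe_toNNReal C
  have hclΨ : IsClosed (Set.range Ψ) := by
    have h1 : Set.range Ψ = ((LinearMap.range (A : E →ₗ[ℂ] E) ⊔
        LinearMap.range (J : (Fin n → ℂ) →ₗ[ℂ] E) : Submodule ℂ E) : Set E) := by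
      rw [← LinearMap.range_coprod]
      rfl
    rw [h1]
    exact Submodule.isClosed_sup_finiteDimensional _ _ hclA
  obtain ⟨K, hK⟩ := Ψ.antilipschitz_of_injective_of_isClosed_range hΨinj hclΨ
  have hK' (p : E × (Fin n → ℂ)) : ‖p‖ ≤ K * ‖Ψ p‖ := by
    simpa using hK.le_mul_dist p 0
  have h1 : Tendsto (fun w : ℂ => K * ‖w‖) (𝓝 0) (𝓝 0) := by
    have : Continuous fun w : ℂ => K * ‖w‖ := by fun_prop
    simpa using this.tendsto 0
  filter_upwards [h1.eventually (gt_mem_nhds one_pos)] with w hw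
  refine natCast_le_eDim.2 ⟨_, (hind _).2 ?_⟩
  rintro c ⟨x, hx⟩
  have hx' : A x - w • x = J c := hx
  have h2 : Ψ (x, -c) = w • x := by
    rw [hΨ, map_neg, ← hx']
    simp
  have h3 := hK' (x, -c)
  rw [h2, norm_smul] at h3
  have h4 : ‖x‖ ≤ ‖(x, -c)‖ := norm_fst_le (x, -c)
  have h5 : ‖(x, -c)‖ = 0 := by
    have h6 : K * (‖w‖ * ‖x‖) ≤ K * ‖w‖ * ‖(x, -c)‖ := by
      rw [← mul_assoc]
      gcongr
    nlinarith [norm_nonneg (x, -c)]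
  have h6 : (x, -c) = (0 : E × (Fin n → ℂ)) := norm_eq_zero.1 h5
  simpa using congrArg Prod.snd h6

/-- A function with values in `ℕ∞` which is locally constant where it is finite and lower
semicontinuous has locally constant finite level sets. -/
theorem eventually_eq_iff {f : ℂ → ℕ∞} {k : ℕ} (h1 : f 0 < ⊤ → ∀ᶠ w in 𝓝 (0 : ℂ), f w = f 0)
    (h2 : ((k + 1 : ℕ) : ℕ∞) ≤ f 0 → ∀ᶠ w in 𝓝 (0 : ℂ), ((k + 1 : ℕ) : ℕ∞) ≤ f w) :
    ∀ᶠ w in 𝓝 (0 : ℂ), f w = k ↔ f 0 = k := by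
  by_cases hfin : f 0 < ⊤
  · filter_upwards [h1 hfin] with w hw
    rw [hw]
  · have htop : f 0 = ⊤ := not_lt_top_iff.1 hfin
    filter_upwards [h2 (by rw [htop]; exact le_top)] with w hw
    refine iff_of_false (fun h => ?_) (by rw [htop]; exact ENat.top_ne_natCast k)
    rw [h] at hw
    have : k + 1 ≤ k := by exact_mod_cast hw
    omega

/-- For a surjective operator `A` with preimages of norm at most `C ‖y‖` a finite nullity is
constant on the disc `‖z‖ < C⁻¹`. -/
theorem nullity_sub_smul_of_surjective [CompleteSpace E] (A : E →L[ℂ] E) {C : ℝ} (hC : 0 < C)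
    (h : ∀ y, ∃ x, A x = y ∧ ‖x‖ ≤ C * ‖y‖) (hfin : nullity A < ⊤) {z : ℂ} (hz : ‖z‖ * C < 1) :
    nullity (A - z • ContinuousLinearMap.id ℂ E) = nullity A := by
  obtain ⟨k, hk⟩ := ENat.ne_top_iff_exists.1 hfin.ne
  have key : ∀ z : ℂ, ‖z‖ < C⁻¹ → ∀ᶠ w in 𝓝 (0 : ℂ),
      nullity (A - (z + w) • ContinuousLinearMap.id ℂ E) = k ↔
        nullity (A - z • ContinuousLinearMap.id ℂ E) = k := by
    intro z hz
    have hz' : ‖z‖ * C < 1 := by rwa [← lt_div_iff₀ hC, one_div]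
    set A' := A - z • ContinuousLinearMap.id ℂ E with hA'
    have hA'w (w : ℂ) : A - (z + w) • ContinuousLinearMap.id ℂ E =
        A' - w • ContinuousLinearMap.id ℂ E := by
      rw [add_smul, hA']
      abel
    have hC' : 0 < C / (1 - ‖z‖ * C) := div_pos hC (by linarith)
    have hs := exists_preimage_sub_smul A hC.le h hz'
    have := eventually_eq_iff (f := fun w => nullity (A' - w • ContinuousLinearMap.id ℂ E))
      (k := k) ?_ ?_
    · simpa only [hA'w, zero_smul, sub_zero] using this
    · simp only [zero_smul, sub_zero]
      intro hfin'
      obtain ⟨B, hB⟩ := exists_rightInverse_of_nullity_lt_top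
        (fun y => (hs y).imp fun _ hx => hx.1) hfin'
      filter_upwards [eventually_bijective_one_sub_smul B] with w hw
      exact nullity_sub_smul_of_bijective hB hw
    · simp only [zero_smul, sub_zero]
      exact eventually_natCast_le_nullity A' hC' hs
  have hz' : ‖z‖ < C⁻¹ := by rwa [← one_div, lt_div_iff₀ hC]
  have := iff_of_eventually_iff (P := fun z => nullity (A - z • ContinuousLinearMap.id ℂ E) = k)
    key hz'
  simp only [zero_smul, sub_zero] at this
  rw [← hk]
  exact this.2 hk.symm

/-- For an operator `A` with `‖x‖ ≤ C ‖A x‖` a finite defect is constant on the disc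
`‖z‖ < C⁻¹`. -/
theorem defect_sub_smul_of_bound [CompleteSpace E] (A : E →L[ℂ] E) {C : ℝ} (hC : 0 < C)
    (h : ∀ x, ‖x‖ ≤ C * ‖A x‖) (hfin : defect A < ⊤) {z : ℂ} (hz : ‖z‖ * C < 1) :
    defect (A - z • ContinuousLinearMap.id ℂ E) = defect A := by
  obtain ⟨k, hk⟩ := ENat.ne_top_iff_exists.1 hfin.ne
  have key : ∀ z : ℂ, ‖z‖ < C⁻¹ → ∀ᶠ w in 𝓝 (0 : ℂ),
      defect (A - (z + w) • ContinuousLinearMap.id ℂ E) = k ↔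
        defect (A - z • ContinuousLinearMap.id ℂ E) = k := by
    intro z hz
    have hz' : ‖z‖ * C < 1 := by rwa [← lt_div_iff₀ hC, one_div]
    set A' := A - z • ContinuousLinearMap.id ℂ E with hA'
    have hA'w (w : ℂ) : A - (z + w) • ContinuousLinearMap.id ℂ E =
        A' - w • ContinuousLinearMap.id ℂ E := by
      rw [add_smul, hA']
      abel
    have hs (x : E) : ‖x‖ ≤ C / (1 - ‖z‖ * C) * ‖A' x‖ := by
      rw [div_mul_eq_mul_div, le_div_iff₀ (by linarith)]
      have h1 : ‖A x‖ ≤ ‖A' x‖ + ‖z‖ * ‖x‖ := by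
        have : A x = A' x + z • x := by simp [hA']
        rw [this, ← norm_smul]
        exact norm_add_le _ _
      have h2 := h x
      have h3 := mul_le_mul_of_nonneg_left h1 hC.le
      linarith
    have hinj : Function.Injective A' := by
      rw [injective_iff_map_eq_zero]
      intro x hx
      have := hs x
      rw [hx, norm_zero, mul_zero] at this
      exact norm_le_zero_iff.1 this
    have := eventually_eq_iff (f := fun w => defect (A' - w • ContinuousLinearMap.id ℂ E))
      (k := k) ?_ ?_
    · simpa only [hA'w, zero_smul, sub_zero] using this
    · simp only [zero_smul, sub_zero]
      intro hfin'
      obtain ⟨B, hB⟩ := exists_leftInverse_of_defect_lt_top hinj hfin'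
      filter_upwards [eventually_bijective_one_sub_smul B] with w hw
      exact defect_sub_smul_of_bijective hB hw
    · simp only [zero_smul, sub_zero]
      exact eventually_natCast_le_defect A' hs
  have hz' : ‖z‖ < C⁻¹ := by rwa [← one_div, lt_div_iff₀ hC]
  have := iff_of_eventually_iff (P := fun z => defect (A - z • ContinuousLinearMap.id ℂ E) = k)
    key hz'
  simp only [zero_smul, sub_zero] at this
  rw [← hk]
  exact this.2 hk.symm

end

end Perturbation

/-! ### Semi-regular operators near zero -/

section

variable {E : Type*} [NormedAddCommGroup E] [NormedSpace ℂ E]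

theorem nullity_restrict (f : E →L[ℂ] E) {W : Submodule ℂ E} (hW : ∀ x ∈ W, f x ∈ W)
    (h : LinearMap.ker (f : E →ₗ[ℂ] E) ≤ W) : nullity (f.restrict hW) = nullity f := by
  have h1 : (LinearMap.ker (f.restrict hW : W →ₗ[ℂ] W)).map W.subtype =
      LinearMap.ker (f : E →ₗ[ℂ] E) := by
    ext x
    constructor
    · rintro ⟨y, hy, rfl⟩
      exact congrArg Subtype.val hy
    · intro hx
      exact ⟨⟨x, h hx⟩, Subtype.ext hx, rfl⟩
  rw [nullity, nullity, ← h1]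
  exact eDim_congr (Submodule.equivMapOfInjective _ W.injective_subtype _)

theorem defect_restrict (f : E →L[ℂ] E) {W : Submodule ℂ E} (hW : ∀ x ∈ W, f x ∈ W)
    (h : ∀ x, f x ∈ W → x ∈ W) (hsup : W ⊔ LinearMap.range (f : E →ₗ[ℂ] E) = ⊤) :
    defect (f.restrict hW) = defect f := by
  let q : W →ₗ[ℂ] E ⧸ LinearMap.range (f : E →ₗ[ℂ] E) :=
    (LinearMap.range (f : E →ₗ[ℂ] E)).mkQ ∘ₗ W.subtype
  have hq : Function.Surjective q := by
    intro y
    obtain ⟨x, rfl⟩ := Submodule.mkQ_surjective _ y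
    obtain ⟨w, hw, r, hr, rfl⟩ := Submodule.mem_sup.1 (hsup ▸ Submodule.mem_top : x ∈ _)
    exact ⟨⟨w, hw⟩, (Submodule.Quotient.eq _).2 (by simpa using neg_mem hr)⟩
  have hk : LinearMap.range (f.restrict hW : W →ₗ[ℂ] W) = LinearMap.ker q := by
    ext w
    have h1 : w ∈ LinearMap.ker q ↔ (w : E) ∈ LinearMap.range (f : E →ₗ[ℂ] E) :=
      Submodule.Quotient.mk_eq_zero _
    rw [h1]
    constructor
    · rintro ⟨x, rfl⟩
      exact ⟨x, rfl⟩
    · rintro ⟨x, hx⟩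
      have hx' : f x = w := hx
      exact ⟨⟨x, h x (hx' ▸ w.2)⟩, Subtype.ext hx⟩
  exact (eDim_congr (Submodule.quotEquivOfEq _ _ hk)).trans
    (eDim_congr (q.quotKerEquivOfSurjective hq))

theorem mem_rangePow_of_sub_smul_mem (S : E →L[ℂ] E) {z : ℂ} (hz : z ≠ 0) {n : ℕ} {x : E}
    (h : (S - z • ContinuousLinearMap.id ℂ E) x ∈ rangePow S n) : x ∈ rangePow S n := by
  have h' : S x - z • x ∈ rangePow S n := h
  clear h
  induction n with
  | zero => exact ⟨x, rfl⟩
  | succ n ih =>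
    have h1 : S x ∈ rangePow S (n + 1) :=
      (mem_rangePow_succ S).2 ⟨x, ih (rangePow_antitone S n.le_succ h'), rfl⟩
    have h2 : z • x ∈ rangePow S (n + 1) := by simpa using sub_mem h1 h'
    exact ((rangePow S (n + 1)).smul_mem_iff hz).1 h2

theorem ker_sub_smul_le_rangePow (S : E →L[ℂ] E) {z : ℂ} (hz : z ≠ 0) (n : ℕ) :
    LinearMap.ker ((S - z • ContinuousLinearMap.id ℂ E : E →L[ℂ] E) : E →ₗ[ℂ] E) ≤
      rangePow S n := fun x hx =>
  mem_rangePow_of_sub_smul_mem S hz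
    ((LinearMap.mem_ker.1 hx : (S - z • ContinuousLinearMap.id ℂ E) x = 0) ▸ zero_mem _)

theorem pow_smul_sub_pow_mem_range_sub_smul (S : E →L[ℂ] E) (z : ℂ) (n : ℕ) {x : E} :
    z ^ n • x - (S ^ n) x ∈
      LinearMap.range ((S - z • ContinuousLinearMap.id ℂ E : E →L[ℂ] E) : E →ₗ[ℂ] E) := by
  induction n with
  | zero => simp
  | succ n ih =>
    obtain ⟨y, hy⟩ := ih
    have hy' : S y - z • y = z ^ n • x - (S ^ n) x := hy
    refine ⟨S y - z ^ n • x, ?_⟩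
    change S (S y - z ^ n • x) - z • (S y - z ^ n • x) = _
    have h1 := congrArg S hy'
    rw [map_sub, map_sub, map_smul, map_smul, ← pow_succ_apply'] at h1
    rw [map_sub, map_smul, smul_sub, smul_smul, ← pow_succ',
      show S (S y) - z ^ n • S x - (z • S y - z ^ (n + 1) • x) =
        (S (S y) - z • S y) - z ^ n • S x + z ^ (n + 1) • x by abel, h1]
    abel

theorem rangePow_sup_range_sub_smul (S : E →L[ℂ] E) {z : ℂ} (hz : z ≠ 0) (n : ℕ) :
    rangePow S n ⊔
      LinearMap.range ((S - z • ContinuousLinearMap.id ℂ E : E →L[ℂ] E) : E →ₗ[ℂ] E) = ⊤ := by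
  rw [eq_top_iff]
  rintro x -
  have h1 := Submodule.add_mem_sup ((mem_rangePow S).2 ⟨x, rfl⟩ : (S ^ n) x ∈ rangePow S n)
    (pow_smul_sub_pow_mem_range_sub_smul S z n (x := x))
  rw [add_sub_cancel] at h1
  exact (Submodule.smul_mem_iff _ (pow_ne_zero n hz)).1 h1

theorem restrict_sub_smul (S : E →L[ℂ] E) (z : ℂ) {W : Submodule ℂ E} (hW : ∀ x ∈ W, S x ∈ W) :
    (S - z • ContinuousLinearMap.id ℂ E).restrict
      (fun x hx => sub_mem (hW x hx) (W.smul_mem z hx) :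
        ∀ x ∈ W, (S - z • ContinuousLinearMap.id ℂ E) x ∈ W) =
      S.restrict hW - z • ContinuousLinearMap.id ℂ W := rfl

theorem nullity_restrPow_sub_smul (S : E →L[ℂ] E) {z : ℂ} (hz : z ≠ 0) (n : ℕ) :
    nullity (restrPow S n - z • ContinuousLinearMap.id ℂ (rangePow S n)) =
      nullity (S - z • ContinuousLinearMap.id ℂ E) := by
  rw [restrPow, ← restrict_sub_smul]
  exact nullity_restrict _ _ (ker_sub_smul_le_rangePow S hz n)

theorem defect_restrPow_sub_smul (S : E →L[ℂ] E) {z : ℂ} (hz : z ≠ 0) (n : ℕ) :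
    defect (restrPow S n - z • ContinuousLinearMap.id ℂ (rangePow S n)) =
      defect (S - z • ContinuousLinearMap.id ℂ E) := by
  rw [restrPow, ← restrict_sub_smul]
  exact defect_restrict _ _ (fun x hx => mem_rangePow_of_sub_smul_mem S hz hx)
    (rangePow_sup_range_sub_smul S hz n)

/-- If `A` has closed iterated ranges, all of which contain its kernel, then `A` maps
`⋂ R(Aⁿ)` onto itself, and this subspace contains the kernels of `A - z` for all `z`. -/
theorem nullity_sub_smul_of_ker_le_rangePow [CompleteSpace E] (A : E →L[ℂ] E) {C : ℝ} (hC : 0 < C)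
    (hA : ∀ x, ∃ x', A x' = A x ∧ ‖x'‖ ≤ C * ‖A x‖)
    (hker : ∀ n, LinearMap.ker (A : E →ₗ[ℂ] E) ≤ rangePow A n)
    (hcl : ∀ n, IsClosed (rangePow A n : Set E)) (hfin : nullity A < ⊤) {z : ℂ} (hz0 : z ≠ 0)
    (hz : ‖z‖ * C < 1) : nullity (A - z • ContinuousLinearMap.id ℂ E) = nullity A := by
  set Z : Submodule ℂ E := ⨅ n, rangePow A n with hZ
  have hZcl : IsClosed (Z : Set E) := by
    rw [hZ, Submodule.coe_iInf]
    exact isClosed_iInter hcl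
  have := hZcl.completeSpace_coe
  have hmem (x : E) : x ∈ Z ↔ ∀ n, x ∈ rangePow A n := Submodule.mem_iInf _
  have hAZ : ∀ x ∈ Z, A x ∈ Z := fun x hx =>
    (hmem _).2 fun n => map_mem_rangePow A n x ((hmem x).1 hx n)
  have hsurj (y : Z) : ∃ x : Z, A.restrict hAZ x = y ∧ ‖x‖ ≤ C * ‖y‖ := by
    obtain ⟨y, hy⟩ := y
    obtain ⟨x₀, -, hx₀⟩ := (mem_rangePow_succ A).1 ((hmem y).1 hy 1)
    obtain ⟨x, hx, hxC⟩ := hA x₀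
    rw [hx₀] at hx hxC
    refine ⟨⟨x, (hmem x).2 fun n => ?_⟩, Subtype.ext hx, hxC⟩
    obtain ⟨x', hx', hx'y⟩ := (mem_rangePow_succ A).1 ((hmem y).1 hy (n + 1))
    have h1 : x - x' ∈ rangePow A n := hker n (by simp [hx, hx'y])
    simpa using add_mem h1 hx'
  have h0 : nullity (A.restrict hAZ) = nullity A :=
    nullity_restrict A hAZ fun x hx => (hmem x).2 fun n => hker n hx
  rw [← h0] at hfin ⊢
  rw [← nullity_sub_smul_of_surjective _ hC hsurj hfin hz, ← restrict_sub_smul]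
  exact (nullity_restrict _ _ fun x hx => (hmem x).2 fun n =>
    ker_sub_smul_le_rangePow A hz0 n hx).symm

theorem ker_pow_le_range (A : E →L[ℂ] E)
    (hker : ∀ n, LinearMap.ker (A : E →ₗ[ℂ] E) ≤ rangePow A n) {n : ℕ} {u : E}
    (hu : (A ^ n) u = 0) : ∃ v, A v = u := by
  induction n generalizing u with
  | zero => exact ⟨0, by simpa using hu.symm⟩
  | succ n ih =>
    have h1 : (A ^ n) u ∈ rangePow A (n + 1) :=
      hker _ ((pow_succ_apply' A n u).symm.trans hu)
    obtain ⟨w, hw⟩ := h1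
    have hw' : (A ^ n) (A w) = (A ^ n) u := (pow_succ_apply A n w).symm.trans hw
    obtain ⟨v, hv⟩ := ih (u := u - A w) (by rw [map_sub, hw', sub_self])
    exact ⟨v + w, by rw [map_add, hv, sub_add_cancel]⟩

/-- The closure `K` of `⋃ N(Aⁿ)`. If all ranges `R(Aⁿ)` contain the kernel of `A`, then every
`A - z` with small `z` maps `K` onto `K`, while `A` induces an operator bounded below on the
quotient by `K`. -/
noncomputable def closureKer (A : E →L[ℂ] E) : Submodule ℂ E :=
  (⨆ n, LinearMap.ker ((A ^ n : E →L[ℂ] E) : E →ₗ[ℂ] E)).topologicalClosure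

theorem mem_iSup_ker_pow (A : E →L[ℂ] E) {x : E} :
    x ∈ ⨆ n, LinearMap.ker ((A ^ n : E →L[ℂ] E) : E →ₗ[ℂ] E) ↔ ∃ n, (A ^ n) x = 0 := by
  rw [Submodule.mem_iSup_of_directed]
  · rfl
  · refine Monotone.directed_le (monotone_nat_of_le_succ fun n x hx => ?_)
    have hx' : (A ^ n) x = 0 := hx
    change (A ^ (n + 1)) x = 0
    rw [pow_succ_apply', hx', map_zero]

theorem map_mem_closureKer (A : E →L[ℂ] E) : ∀ x ∈ closureKer A, A x ∈ closureKer A := by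
  intro x hx
  refine Set.MapsTo.closure (fun y hy => ?_) A.continuous hx
  obtain ⟨n, hn⟩ := (mem_iSup_ker_pow A).1 hy
  exact (mem_iSup_ker_pow A).2 ⟨n, by rw [← pow_succ_apply, pow_succ_apply', hn, map_zero]⟩

/-- `A` maps `⋃ N(Aⁿ)`, which is dense in its closure `K`, onto itself with controlled preimages, so
successive approximation solves `(A - z) x = y` in `K`. -/
theorem exists_sub_smul_eq_of_mem_closureKer [CompleteSpace E] (A : E →L[ℂ] E) {C : ℝ} (hC : 0 < C)
    (hA : ∀ x, ∃ x', A x' = A x ∧ ‖x'‖ ≤ C * ‖A x‖)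
    (hker : ∀ n, LinearMap.ker (A : E →ₗ[ℂ] E) ≤ rangePow A n) {z : ℂ} (hz : ‖z‖ * C < 1)
    {y : E} (hy : y ∈ closureKer A) :
    ∃ x ∈ closureKer A, (A - z • ContinuousLinearMap.id ℂ E) x = y := by
  have hKcl : IsClosed (closureKer A : Set E) := Submodule.isClosed_topologicalClosure _
  have := hKcl.completeSpace_coe
  -- The approximation error `q` is chosen such that `q + ‖z‖ C (1 + q) < 1`.
  set a := ‖z‖ * C with ha
  have ha0 : 0 ≤ a := by positivity
  obtain ⟨q, hq0, hq⟩ : ∃ q : ℝ, 0 < q ∧ q + a * (1 + q) < 1 :=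
    ⟨(1 - a) / 4, by linarith, by nlinarith⟩
  let g := A.restrict (map_mem_closureKer A) - z • ContinuousLinearMap.id ℂ (closureKer A)
  suffices happ : ∀ y : closureKer A,
      ∃ x, ‖y - g x‖ ≤ (q + a * (1 + q)) * ‖y‖ ∧ ‖x‖ ≤ C * (1 + q) * ‖y‖ by
    obtain ⟨x, hx, -⟩ := exists_preimage_of_approx g (by positivity) (by positivity) hq happ ⟨y, hy⟩
    exact ⟨x, x.2, congrArg Subtype.val hx⟩
  clear hy y
  rintro ⟨y, hy⟩
  by_cases hy0 : y = 0
  · subst hy0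
    exact ⟨0, by simp, by simp⟩
  have hpos : 0 < q * ‖y‖ := mul_pos hq0 (norm_pos_iff.2 hy0)
  obtain ⟨u, hu, huy⟩ := Metric.mem_closure_iff.1 hy _ hpos
  obtain ⟨n, hn⟩ := (mem_iSup_ker_pow A).1 hu
  obtain ⟨v₀, hv₀⟩ := ker_pow_le_range A hker hn
  obtain ⟨v, hv, hvC⟩ := hA v₀
  rw [hv₀] at hv hvC
  have hvK : v ∈ closureKer A := Submodule.le_topologicalClosure _
    ((mem_iSup_ker_pow A).2 ⟨n + 1, by rw [pow_succ_apply, hv, hn]⟩)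
  rw [dist_eq_norm] at huy
  have hunorm : ‖u‖ ≤ (1 + q) * ‖y‖ := by
    have := norm_sub_norm_le u y
    rw [norm_sub_rev] at this
    linarith
  have hvnorm : ‖v‖ ≤ C * (1 + q) * ‖y‖ := by
    rw [mul_assoc]
    exact hvC.trans (mul_le_mul_of_nonneg_left hunorm hC.le)
  refine ⟨⟨v, hvK⟩, ?_, hvnorm⟩
  change ‖y - (A v - z • v)‖ ≤ (q + a * (1 + q)) * ‖y‖
  rw [hv]
  calc ‖y - (u - z • v)‖ = ‖(y - u) + z • v‖ := by congr 1; abel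
    _ ≤ ‖y - u‖ + ‖z‖ * ‖v‖ := (norm_add_le _ _).trans_eq (by rw [norm_smul])
    _ ≤ q * ‖y‖ + ‖z‖ * (C * (1 + q) * ‖y‖) := by gcongr
    _ = (q + a * (1 + q)) * ‖y‖ := by rw [ha]; ring

/-- On the quotient by the closure `K` of `⋃ N(Aⁿ)` the operator induced by `A` is bounded below
with the constant `C`. As `A - z` maps `K` onto itself, passing to the quotient preserves its
defect. -/
theorem defect_sub_smul_of_ker_le_rangePow [CompleteSpace E] (A : E →L[ℂ] E) {C : ℝ} (hC : 0 < C)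
    (hA : ∀ x, ∃ x', A x' = A x ∧ ‖x'‖ ≤ C * ‖A x‖)
    (hker : ∀ n, LinearMap.ker (A : E →ₗ[ℂ] E) ≤ rangePow A n) (hfin : defect A < ⊤) {z : ℂ}
    (hz : ‖z‖ * C < 1) : defect (A - z • ContinuousLinearMap.id ℂ E) = defect A := by
  set K := closureKer A with hK
  have hKcl : IsClosed (K : Set E) := Submodule.isClosed_topologicalClosure _
  have : IsClosed (K : Set E) := hKcl
  have hAK := map_mem_closureKer A
  have hsolve {w : ℂ} (hw : ‖w‖ * C < 1) {y : E} (hy : y ∈ K) :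
      ∃ x ∈ K, (A - w • ContinuousLinearMap.id ℂ E) x = y :=
    exists_sub_smul_eq_of_mem_closureKer A hC hA hker hw hy
  let Q : (E ⧸ K) →L[ℂ] (E ⧸ K) := K.liftQL (K.mkQL ∘L A) (by
    intro x hx
    exact (Submodule.Quotient.mk_eq_zero K).2 (hAK x hx))
  have hQ (x : E) : Q (K.mkQ x) = K.mkQ (A x) := rfl
  have hdef (w : ℂ) (hw : ‖w‖ * C < 1) : defect (A - w • ContinuousLinearMap.id ℂ E) =
      defect (Q - w • ContinuousLinearMap.id ℂ (E ⧸ K)) := by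
    set R := LinearMap.range
      ((Q - w • ContinuousLinearMap.id ℂ (E ⧸ K) : (E ⧸ K) →L[ℂ] (E ⧸ K)) :
        (E ⧸ K) →ₗ[ℂ] (E ⧸ K))
    have hQw (x : E) : (Q - w • ContinuousLinearMap.id ℂ (E ⧸ K)) (K.mkQ x) =
        K.mkQ ((A - w • ContinuousLinearMap.id ℂ E) x) := rfl
    have hsurj : Function.Surjective (R.mkQ ∘ₗ K.mkQ) :=
      (Submodule.mkQ_surjective R).comp (Submodule.mkQ_surjective K)
    have hk : LinearMap.range ((A - w • ContinuousLinearMap.id ℂ E : E →L[ℂ] E) : E →ₗ[ℂ] E) =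
        LinearMap.ker (R.mkQ ∘ₗ K.mkQ) := by
      ext x
      have h1 : x ∈ LinearMap.ker (R.mkQ ∘ₗ K.mkQ) ↔ K.mkQ x ∈ R :=
        Submodule.Quotient.mk_eq_zero R
      rw [h1]
      constructor
      · rintro ⟨y, rfl⟩
        exact ⟨K.mkQ y, hQw y⟩
      · rintro ⟨y, hy⟩
        obtain ⟨y, rfl⟩ := Submodule.mkQ_surjective _ y
        have h2 : K.mkQ ((A - w • ContinuousLinearMap.id ℂ E) y) = K.mkQ x := (hQw y).symm.trans hy
        have h3 := (Submodule.Quotient.eq K).1 h2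
        obtain ⟨v, -, hv⟩ := hsolve hw h3
        refine ⟨y - v, ?_⟩
        change (A - w • ContinuousLinearMap.id ℂ E) (y - v) = x
        rw [map_sub, hv]
        abel
    exact (eDim_congr (Submodule.quotEquivOfEq _ _ hk)).trans
      (eDim_congr ((R.mkQ ∘ₗ K.mkQ).quotKerEquivOfSurjective hsurj))
  have hbound (ξ : E ⧸ K) : ‖ξ‖ ≤ C * ‖Q ξ‖ := by
    obtain ⟨x, rfl⟩ := Submodule.mkQ_surjective _ ξ
    refine le_of_forall_pos_le_add fun ε hε => ?_
    obtain ⟨y, hy, hyn⟩ := Submodule.Quotient.norm_mk_lt (Q (K.mkQ x)) (div_pos hε hC)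
    have h1 : A x - y ∈ K := (Submodule.Quotient.eq K).1 ((hQ x).symm.trans hy.symm)
    obtain ⟨v, hv, hvA⟩ := hsolve (w := 0) (by simp) h1
    have hvA' : A v = A x - y := by simpa using hvA
    obtain ⟨x', hx', hx'C⟩ := hA (x - v)
    have h2 : A (x - v) = y := by rw [map_sub, hvA']; abel
    rw [h2] at hx' hx'C
    have h3 : K.mkQ x = K.mkQ x' := by
      refine (Submodule.Quotient.eq K).2 ?_
      have h4 : x - v - x' ∈ K := Submodule.le_topologicalClosure _
        ((mem_iSup_ker_pow A).2 ⟨1, by rw [pow_one, map_sub, h2, hx', sub_self]⟩)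
      have h5 := add_mem h4 hv
      rwa [show x - v - x' + v = x - x' by abel] at h5
    calc ‖K.mkQ x‖ = ‖K.mkQ x'‖ := by rw [h3]
      _ ≤ ‖x'‖ := Submodule.Quotient.norm_mk_le K x'
      _ ≤ C * ‖y‖ := hx'C
      _ ≤ C * (‖Q (K.mkQ x)‖ + ε / C) := by gcongr
      _ = C * ‖Q (K.mkQ x)‖ + ε := by field_simp
  have h0 : defect A = defect Q := by
    have h := hdef 0 (by simp)
    have hQ0 : Q - (0 : ℂ) • ContinuousLinearMap.id ℂ (E ⧸ K) = Q :=
      ContinuousLinearMap.ext fun ξ => (congrArg (Q ξ - ·) (zero_smul ℂ ξ)).trans (sub_zero _)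
    rwa [hQ0, zero_smul, sub_zero] at h
  rw [hdef z hz, h0]
  exact defect_sub_smul_of_bound Q hC hbound (h0 ▸ hfin) hz

/-! ### The reduced minimum modulus -/

/-- If `‖z‖` is less than the reduced minimum modulus, there is a constant `C` with `‖z‖ * C < 1`
such that every value `A x` is attained at a point of norm at most `C * ‖A x‖`. -/
theorem exists_bound_of_lt_reducedMinModulus (A : E →L[ℂ] E) {z : ℂ}
    (hz : ‖z‖ₑ < reducedMinModulus A) :
    ∃ C : ℝ, 0 < C ∧ ‖z‖ * C < 1 ∧ ∀ x, ∃ x', A x' = A x ∧ ‖x'‖ ≤ C * ‖A x‖ := by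
  obtain ⟨r, hzr, hr⟩ := ENNReal.lt_iff_exists_nnreal_btwn.1 hz
  have hzr' : ‖z‖ < r := by
    have : ‖z‖₊ < r := by exact_mod_cast hzr
    exact this
  obtain ⟨s, hzs, hsr⟩ := exists_between hzr'
  have hs : 0 < s := (norm_nonneg z).trans_lt hzs
  refine ⟨s⁻¹, inv_pos.2 hs, by rwa [← div_eq_mul_inv, div_lt_one hs], fun x => ?_⟩
  set N := LinearMap.ker (A : E →ₗ[ℂ] E)
  by_cases hx : x ∈ N
  · have hx' : A x = 0 := hx
    exact ⟨0, by simp [hx'], by simp [hx']⟩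
  have h1 : (r : ℝ≥0∞) ≤ ENNReal.ofReal (‖A x‖ / Metric.infDist x (N : Set E)) :=
    hr.le.trans (iInf₂_le x hx)
  have hAx : 0 < ‖A x‖ := norm_pos_iff.2 hx
  have h2 : (r : ℝ) ≤ ‖A x‖ / Metric.infDist x (N : Set E) := by
    rw [← ENNReal.ofReal_coe_nnreal] at h1
    exact (ENNReal.ofReal_le_ofReal_iff (div_nonneg hAx.le Metric.infDist_nonneg)).1 h1
  have hpos : 0 < Metric.infDist x (N : Set E) :=
    (A.isClosed_ker.notMem_iff_infDist_pos ⟨0, N.zero_mem⟩).1 hx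
  have h3 : Metric.infDist x (N : Set E) < s⁻¹ * ‖A x‖ := by
    rw [le_div_iff₀ hpos] at h2
    rw [← div_eq_inv_mul, lt_div_iff₀ hs]
    nlinarith
  obtain ⟨y, hy, hxy⟩ := (Metric.infDist_lt_iff ⟨0, N.zero_mem⟩).1 h3
  have hy' : A y = 0 := hy
  exact ⟨x - y, by rw [map_sub, hy', sub_zero], by rw [← dist_eq_norm]; exact hxy.le⟩

theorem reducedMinModulus_pos [CompleteSpace E] (A : E →L[ℂ] E)
    (hcl : IsClosed (LinearMap.range (A : E →ₗ[ℂ] E) : Set E)) : 0 < reducedMinModulus A := by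
  have := hcl.completeSpace_coe
  obtain ⟨C, hC, h⟩ := ContinuousLinearMap.exists_preimage_norm_le
    (A.codRestrict (LinearMap.range (A : E →ₗ[ℂ] E)) fun x => ⟨x, rfl⟩)
    (by rintro ⟨_, x, rfl⟩; exact ⟨x, rfl⟩)
  refine lt_of_lt_of_le (ENNReal.ofReal_pos.2 (inv_pos.2 hC)) (le_iInf₂ fun x hx => ?_)
  refine ENNReal.ofReal_le_ofReal ?_
  have hpos := (A.isClosed_ker.notMem_iff_infDist_pos
    ⟨0, zero_mem (LinearMap.ker (A : E →ₗ[ℂ] E))⟩).1 hx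
  obtain ⟨x', hx', hn⟩ := h ⟨A x, x, rfl⟩
  have hx'' : A x' = A x := congrArg Subtype.val hx'
  have hmem : x - x' ∈ LinearMap.ker (A : E →ₗ[ℂ] E) := by simp [hx'']
  have h1 := Metric.infDist_le_dist_of_mem (x := x) (SetLike.mem_coe.2 hmem)
  rw [dist_eq_norm, sub_sub_cancel] at h1
  rw [le_div_iff₀ hpos, ← div_eq_inv_mul, div_le_iff₀' hC]
  exact h1.trans hn

/-! ### Operators with `dis S` equal to the essential degree -/

theorem coe_restrPow_pow_apply (S : E →L[ℂ] E) (m n : ℕ) (x : rangePow S m) :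
    ((restrPow S m ^ n) x : E) = (S ^ n) x :=
  coe_restrict_pow_apply (map_mem_rangePow S m) n x

theorem mem_rangePow_restrPow (S : E →L[ℂ] E) (m n : ℕ) (x : rangePow S m) :
    x ∈ rangePow (restrPow S m) n ↔ (x : E) ∈ rangePow S (m + n) := by
  constructor
  · rintro ⟨⟨_, y, rfl⟩, rfl⟩
    refine ⟨y, ?_⟩
    rw [add_comm]
    exact (pow_add_apply S n m y).trans (coe_restrPow_pow_apply S m n ⟨(S ^ m) y, y, rfl⟩).symm
  · rintro ⟨y, hy⟩
    refine ⟨⟨(S ^ m) y, y, rfl⟩, Subtype.ext ?_⟩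
    rw [add_comm] at hy
    exact (coe_restrPow_pow_apply S m n _).trans ((pow_add_apply S n m y).symm.trans hy)

theorem StableFrom.ker_restrPow_le {S : E →L[ℂ] E} {m : ℕ} (h : StableFrom S m) (n : ℕ) :
    LinearMap.ker (restrPow S m : rangePow S m →ₗ[ℂ] rangePow S m) ≤
      rangePow (restrPow S m) n := by
  intro x hx
  rw [mem_rangePow_restrPow]
  have h1 : (x : E) ∈ kerRestrPow S m := ⟨x, hx, rfl⟩
  rw [h (m + n) (Nat.le_add_right m n)] at h1
  exact ((mem_kerRestrPow S).1 h1).2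

theorem StableFrom.isSemiRegular_restrPow {S : E →L[ℂ] E} {m : ℕ} (h : StableFrom S m)
    (hcl : IsClosed (rangePow S (m + 1) : Set E)) : IsSemiRegular (restrPow S m) := by
  refine ⟨?_, dis_eq_natCast_iff.2 ⟨fun r _ => ?_, fun b _ => b.zero_le⟩⟩
  · rw [range_restrPow_eq_preimage]
    exact hcl.preimage continuous_subtype_val
  · ext x
    rw [mem_kerRestrPow, mem_kerRestrPow]
    exact ⟨fun hx => ⟨hx.1, h.ker_restrPow_le r hx.1⟩, fun hx => ⟨hx.1, ⟨x, rfl⟩⟩⟩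

/-- An operator whose iteration is stable from the essential degree on has no jump. -/
theorem IsSemiBFredholm.hasJump_zero [CompleteSpace E] {S : E →L[ℂ] E} (hS : IsSemiBFredholm S)
    {m : ℕ} (hm : essDegree S = m) (hst : StableFrom S m) : HasJump S 0 := by
  obtain ⟨m', hm', -, hcl⟩ := hS.exists_essDegree_eq
  obtain rfl : m' = m := by exact_mod_cast hm'.symm.trans hm
  have := (hcl m' le_rfl).completeSpace_coe
  have hcl' (n : ℕ) : IsClosed (rangePow (restrPow S m') n : Set (rangePow S m')) := by
    have : (rangePow (restrPow S m') n : Set (rangePow S m')) =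
        Subtype.val ⁻¹' (rangePow S (m' + n) : Set E) := by
      ext x
      exact mem_rangePow_restrPow S m' n x
    rw [this]
    exact (hcl _ (Nat.le_add_right _ _)).preimage continuous_subtype_val
  refine ⟨hS, m', m', hm, dis_eq_natCast_iff.2 ⟨hst, fun b => essDegree_le_of_stableFrom hm⟩,
    reducedMinModulus_pos _ (hst.isSemiRegular_restrPow (hcl _ m'.le_succ)).1, ?_, ?_⟩
  · rintro ⟨a, ha, -⟩ z hz0 hz
    obtain rfl : m' = a := by exact_mod_cast hm.symm.trans (essDegree_eq_of_essAscent_eq S ha)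
    obtain ⟨C, hC, hzC, hA⟩ := exists_bound_of_lt_reducedMinModulus _ hz
    rw [← nullity_restrPow_sub_smul S hz0 m', nullity_sub_smul_of_ker_le_rangePow _ hC hA
      hst.ker_restrPow_le hcl' (iInf_natCast_eq_natCast_iff.1 ha).1 hz0 hzC]
    simp
  · rintro ⟨b, hb, -⟩ z hz0 hz
    obtain rfl : m' = b := by exact_mod_cast hm.symm.trans (essDegree_eq_of_essDescent_eq S hb)
    obtain ⟨C, hC, hzC, hA⟩ := exists_bound_of_lt_reducedMinModulus _ hz
    rw [← defect_restrPow_sub_smul S hz0 m', defect_sub_smul_of_ker_le_rangePow _ hC hA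
      hst.ker_restrPow_le (iInf_natCast_eq_natCast_iff.1 hb).1 hzC]
    simp

end

end SemiBFredholm

theorem mainTheorem1 {X : Type*} [NormedAddCommGroup X] [NormedSpace ℂ X] [CompleteSpace X]
    (T : X →L[ℂ] X) (hT : SemiBFredholm.IsSemiBFredholm T) :
    ∃ m d : ℕ, SemiBFredholm.essDegree T = m ∧ SemiBFredholm.dis T = d ∧
      ∃ (M N : Submodule ℂ X) (h : SemiBFredholm.IsReducedBy T M N),
        FiniteDimensional ℂ N ∧
        SemiBFredholm.IsSemiBFredholm (T.restrict h.map_left) ∧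
        SemiBFredholm.HasJump (T.restrict h.map_left) 0 ∧
        SemiBFredholm.dis (T.restrict h.map_left) = m ∧
        SemiBFredholm.IsSemiRegular (SemiBFredholm.restrPow (T.restrict h.map_left) m) ∧
        IsNilpotent (T.restrict h.map_right) ∧
        nilpotencyClass (T.restrict h.map_right) = d ∧
        SemiBFredholm.index T = SemiBFredholm.index (T.restrict h.map_left) := by
  open SemiBFredholm in
  obtain ⟨m, hm, hfin, hcl⟩ := hT.exists_essDegree_eq
  obtain ⟨d, hd⟩ := exists_dis_eq hfin
  have hmd : m ≤ d := essDegree_le_of_stableFrom hm (dis_eq_natCast_iff.1 hd).1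
  obtain ⟨k, hk⟩ := ENat.ne_top_iff_exists.1 hfin.ne
  obtain ⟨M, N, hr, hN, hnil, hst⟩ := exists_isReducedBy_stableFrom k T hd hcl hmd hk.symm
  obtain ⟨e, he⟩ := hr.isDirectSum
  have := hr.isClosed_left.completeSpace_coe
  have hM : IsSemiBFredholm (T.restrict hr.map_left) := he.isSemiBFredholm hT
  have hmM : essDegree (T.restrict hr.map_left) = m := he.essDegree_eq ▸ hm
  refine ⟨m, d, hm, hd, M, N, hr, hN, hM, hM.hasJump_zero hmM hst,
    dis_eq_natCast_iff.2 ⟨hst, fun b => essDegree_le_of_stableFrom hmM⟩,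
    hst.isSemiRegular_restrPow (he.isClosed_rangePow (hcl _ m.le_succ)),
    ⟨d, (hnil d).2 le_rfl⟩, ?_, he.index_eq⟩
  have hset : {n | (T.restrict hr.map_right) ^ n = 0} = Set.Ici d := Set.ext hnil
  rw [nilpotencyClass, hset, csInf_Ici]
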